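/- For a finite simple graph $G$ let $\delta(G)$ be its minimum degree, and let $r_g(G,\mathcal{H})$ be the global resilience of $G$ with respect to Hamiltonicity, that is, the minimal integer $m \ge 0$ for which there is a subgraph $H \subseteq G$ with exactly $m$ edges such that $G \setminus H$ (the graph obtained from $G$ by deleting the edges of $H$) is not Hamiltonian. Let $p = p(n) \in [0,1]$ be an arbitrary sequence and let $G \sim G(n,p)$ be the binomial random graph on $n$ vertices, in which each pair of vertices is an edge independently with probability $p(n)$. Then, with high probability, $r_g(G,\mathcal{H}) = \max\{0, \delta(G) - 1\}$; that is, $$\lim_{n \to \infty} \mathbb{P}\bigl( r_g(G,\mathcal{H}) = \max\{0, \delta(G) - 1\} \bigr) = 1 .$$ -/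

import Mathlib

open Filter Topology

namespace GlobalResilience

variable {V : Type*}

/-- The numbers `e(H)` of edges of the subgraphs `H ⊆ G` whose removal (as a set of edges, all
vertices being kept) destroys the graph property `P`. -/
def destroyingSizes (G : SimpleGraph V) (P : SimpleGraph V → Prop) : Set ℕ :=
  {m | ∃ H : SimpleGraph V, H ≤ G ∧ H.edgeSet.ncard = m ∧ ¬ P (G \ H)}

/-- The global resilience `r_g(G, P)` of a finite graph `G` with respect to a (monotone increasing)
graph property `P`: the minimal number of edges whose removal from `G` destroys `P`. It is a genuine
minimum as soon as the edgeless graph does not satisfy `P`, see `isLeast_globalResilience`. -/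
noncomputable def globalResilience (G : SimpleGraph V) (P : SimpleGraph V → Prop) : ℕ :=
  sInf (destroyingSizes G P)

theorem isLeast_globalResilience (G : SimpleGraph V) (P : SimpleGraph V → Prop) (hP : ¬ P ⊥) :
    IsLeast (destroyingSizes G P) (globalResilience G P) := by
  have hne : (destroyingSizes G P).Nonempty := ⟨G.edgeSet.ncard, G, le_rfl, rfl, by simpa using hP⟩
  exact ⟨Nat.sInf_mem hne, fun m hm => Nat.sInf_le hm⟩

/-- Hamiltonicity of graphs on `n` vertices, for `n ≠ 1`, meets the condition of
`isLeast_globalResilience`. -/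
theorem not_isHamiltonian_bot (n : ℕ) (hn : n ≠ 1) :
    ¬ (⊥ : SimpleGraph (Fin n)).IsHamiltonian := by
  intro h
  obtain ⟨a, w, hw⟩ := h (by simpa using hn)
  cases w with
  | nil => exact hw.isCycle.not_nil (by simp)
  | cons hadj _ => exact hadj

open scoped Classical in
/-- The minimum degree `δ(G)` of a finite graph. -/
noncomputable def minDeg [Fintype V] (G : SimpleGraph V) : ℕ := G.minDegree

end GlobalResilience

/-! The upper bound is deterministic: deleting all but one edge at a vertex of minimum degree leaves
a vertex of degree at most one. For the lower bound write q = np and split at q = (3/4) log n.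

Below the split, the second moment method gives an isolated vertex with high probability
(`prob_no_isolated_le`), so the minimum degree and the resilience are both zero.

Above it, G is with high probability pseudorandom in the sense of `IsRobust`: vertices of low degree
are far apart, small sets span few edges, large disjoint sets are joined by many edges, G has at
most about qn edges, and every sparse subgraph of G with quadratically many boosters has more than h
of them among the edges of G, where h is about 2q. The rest is deterministic
(`IsRobust.isHamiltonian_sdiff`). Let F = G \ H, where H has at most δ(G) - 2 edges. Then F has
minimum degree at least two, and it contains a subgraph Γ with few edges that expands and has no
cut: a small set of edges meeting all the large bipartite pieces, together with up to D edges at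
each vertex (`exists_sparse_expander`). By Pósa rotations (`card_extNbrs_endpoints_lt`), an expander
that is not Hamiltonian has quadratically many boosters (`Expands.card_boosters`). H is too small to
contain all those lying in G, so F contains one. Adding boosters lengthens a longest path each time
until F is Hamiltonian (`isHamiltonian_of_boosters`).

The sparsity of Γ is essential. The booster property needs a union bound over all possible Γ, whose
number is kept in check by the probability p^e(Γ) that Γ lies in G (`prob_not_boost_le`). -/

namespace GlobalResilience

/-! ### Pósa rotations and the end vertices of longest paths -/

section Posa

variable {V : Type*}

/-- A list of distinct vertices that spells out a path of `Γ`. -/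
structure IsPathList (Γ : SimpleGraph V) (l : List V) : Prop where
  chain : l.IsChain Γ.Adj
  nodup : l.Nodup

/-- A path with the largest possible number of vertices. -/
structure IsLongestPath (Γ : SimpleGraph V) (l : List V) : Prop extends IsPathList Γ l where
  longest : ∀ l', IsPathList Γ l' → l'.length ≤ l.length

/-- The paths reachable from `l₀` by Pósa rotations that keep the first vertex. -/
inductive Rotated (Γ : SimpleGraph V) (l₀ : List V) : List V → Prop
  | refl : Rotated Γ l₀ l₀
  | step (a b : List V) (x u : V) : Rotated Γ l₀ (a ++ x :: (b ++ [u])) → Γ.Adj x u →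
      Rotated Γ l₀ (a ++ x :: u :: b.reverse)

/-- A rotation only reverses a segment and creates one new consecutive pair. The relation is
arbitrary because Pósa's lemma also transports an invariant other than adjacency. -/
theorem isChain_rotate {R : V → V → Prop} (hR : ∀ x y, R x y → R y x) {a b : List V} {x u : V}
    (h : (a ++ x :: (b ++ [u])).IsChain R) (hxu : R x u) :
    (a ++ x :: u :: b.reverse).IsChain R := by
  rw [List.isChain_split] at h ⊢
  refine ⟨h.1, ?_⟩
  rw [List.isChain_cons_cons]
  refine ⟨hxu, ?_⟩
  have h2 : (b ++ [u]).IsChain R := (List.isChain_cons.1 h.2).2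
  have h3 : (b ++ [u]).reverse.IsChain R := by
    rw [List.isChain_reverse]
    exact h2.imp fun a b hab => hR _ _ hab
  simpa using h3

theorem IsPathList.rotate {Γ : SimpleGraph V} {a b : List V} {x u : V}
    (h : IsPathList Γ (a ++ x :: (b ++ [u]))) (hxu : Γ.Adj x u) :
    IsPathList Γ (a ++ x :: u :: b.reverse) := by
  refine ⟨isChain_rotate (fun x y => Γ.symm.symm x y) h.chain hxu, ?_⟩
  have hp : (a ++ x :: u :: b.reverse).Perm (a ++ x :: (b ++ [u])) := by
    refine List.Perm.append_left _ (List.Perm.cons _ ?_)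
    have : (b ++ [u]).reverse.Perm (b ++ [u]) := List.reverse_perm _
    simpa using this
  exact hp.nodup_iff.2 h.nodup

theorem IsPathList.reverse {Γ : SimpleGraph V} {l : List V} (h : IsPathList Γ l) :
    IsPathList Γ l.reverse := by
  refine ⟨?_, by simpa using h.nodup⟩
  rw [List.isChain_reverse]
  exact h.chain.imp fun a b hab => hab.symm

theorem Rotated.isLongestPath {Γ : SimpleGraph V} {l₀ l : List V} (h : Rotated Γ l₀ l)
    (h₀ : IsLongestPath Γ l₀) : IsLongestPath Γ l := by
  induction h with
  | refl => exact h₀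
  | step a b x u _ hxu ih =>
    refine ⟨ih.toIsPathList.rotate hxu, fun l' hl' => (ih.longest l' hl').trans (by simp)⟩

theorem Rotated.head? {Γ : SimpleGraph V} {l₀ l : List V} (h : Rotated Γ l₀ l) :
    l.head? = l₀.head? := by
  induction h with
  | refl => rfl
  | step a b x u _ hxu ih => rw [← ih]; cases a <;> simp

/-- `r` and `z` are consecutive, in this order, in the list `l`. -/
def Consec (l : List V) (r z : V) : Prop := ∃ i, ∃ h : i + 1 < l.length, l[i] = r ∧ l[i + 1] = z

theorem Consec.eq_right {l : List V} (hl : l.Nodup) {r z z' : V} (h : Consec l r z)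
    (h' : Consec l r z') : z = z' := by
  obtain ⟨i, hi, rfl, rfl⟩ := h
  obtain ⟨j, hj, h1, rfl⟩ := h'
  have := (hl.getElem_inj_iff).1 h1
  subst this; rfl

theorem Consec.eq_left {l : List V} (hl : l.Nodup) {r z z' : V} (h : Consec l z r)
    (h' : Consec l z' r) : z = z' := by
  obtain ⟨i, hi, rfl, rfl⟩ := h
  obtain ⟨j, hj, rfl, h1⟩ := h'
  have := (hl.getElem_inj_iff).1 h1
  have : j = i := by omega
  subst this; rfl

/-- The last vertices of the rotations of `l₀`. -/
def endpoints (Γ : SimpleGraph V) (l₀ : List V) : Set V := {v | ∃ l, Rotated Γ l₀ (l ++ [v])}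

variable [Fintype V]

open scoped Classical in
/-- The neighbours of the vertices of `S` outside `S`. -/
noncomputable def extNbrs (Γ : SimpleGraph V) (S : Finset V) : Finset V :=
  Finset.univ.filter fun v => v ∉ S ∧ ∃ u ∈ S, Γ.Adj u v

omit [Fintype V] in
-- A rotation at x breaks the pair formed by x and its successor, and that successor becomes an
-- endpoint. So a vertex of W, which is neither an endpoint nor next to one on the original path,
-- keeps its original path neighbours under all rotations. If such a w were adjacent to an endpoint
-- u, rotating at w would make its successor an endpoint, although this successor is still a
-- neighbour of w on the original path.
theorem exists_consec_of_adj_endpoint {Γ : SimpleGraph V} {l₀ : List V} (h₀ : IsLongestPath Γ l₀)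
    {u w : V} (hu : u ∈ endpoints Γ l₀) (hw : w ∉ endpoints Γ l₀) (huw : Γ.Adj u w) :
    ∃ r ∈ endpoints Γ l₀, Consec l₀ r w ∨ Consec l₀ w r := by
  by_contra! hcon
  set R := endpoints Γ l₀ with hR
  set W : Set V := {w | w ∉ R ∧ ∀ r ∈ R, ¬ Consec l₀ r w ∧ ¬ Consec l₀ w r} with hW
  have hinv : ∀ l, Rotated Γ l₀ l →
      l.IsChain (fun p q => (Consec l₀ p q ∨ Consec l₀ q p) ∨ (p ∉ W ∧ q ∉ W)) := by
    intro l hl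
    induction hl with
    | refl =>
      rw [List.isChain_iff_getElem]
      intro i hi
      exact Or.inl (Or.inl ⟨i, hi, rfl, rfl⟩)
    | step a b x u hrot hxu ih =>
      refine isChain_rotate (fun x y h => by tauto) ih ?_
      have huR : u ∈ R := ⟨a ++ x :: b, by simpa using hrot⟩
      refine Or.inr ⟨fun hx => ?_, fun hu => hu.1 huR⟩
      -- The successor y of x becomes the last vertex after the rotation, so it is an endpoint.
      -- Hence x in W contradicts the induction hypothesis for the pair x, y.
      have hne : ∃ y b', b ++ [u] = y :: b' := by cases b <;> simp
      obtain ⟨y, b', hyb⟩ := hne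
      have hyR : y ∈ R := by
        have := Rotated.step a b x u hrot hxu
        have h2 : u :: b.reverse = b'.reverse ++ [y] := by
          have := congrArg List.reverse hyb
          simpa using this
        rw [h2] at this
        exact ⟨a ++ x :: b'.reverse, by simpa using this⟩
      rw [hyb, List.isChain_append_cons_cons] at ih
      rcases ih.2.1 with h | h
      · have := hx.2 y hyR; tauto
      · exact h.1 hx
  obtain ⟨l, hl⟩ := hu
  have hlong := hl.isLongestPath h₀
  -- By maximality every neighbour of an end vertex lies on the path.
  have hwl : w ∈ l ++ [u] := by
    by_contra hwl
    have : IsPathList Γ (l ++ [u] ++ [w]) := by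
      refine ⟨?_, ?_⟩
      · have h1 := hlong.chain
        rw [List.append_assoc, List.cons_append, List.nil_append, List.isChain_append_cons_cons]
        exact ⟨h1, huw, by simp⟩
      · rw [List.nodup_append]
        refine ⟨hlong.nodup, by simp, ?_⟩
        rintro a ha b hb rfl
        simp only [List.mem_singleton] at hb
        subst hb; exact hwl ha
    have := hlong.longest _ this
    simp at this
  have hwl' : w ∈ l := by
    rcases List.mem_append.1 hwl with h | h
    · exact h
    · simp only [List.mem_singleton] at h
      exact absurd h huw.ne'
  obtain ⟨a, b, rfl⟩ := List.append_of_mem hwl'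
  have hrot : Rotated Γ l₀ (a ++ w :: (b ++ [u])) := by simpa using hl
  have hne : ∃ y b', b ++ [u] = y :: b' := by cases b <;> simp
  obtain ⟨y, b', hyb⟩ := hne
  have hyR : y ∈ R := by
    have := Rotated.step a b w u hrot huw.symm
    have h2 : u :: b.reverse = b'.reverse ++ [y] := by
      have := congrArg List.reverse hyb
      simpa using this
    rw [h2] at this
    exact ⟨a ++ w :: b'.reverse, by simpa using this⟩
  have hch := hinv _ hrot
  rw [hyb, List.isChain_append_cons_cons] at hch
  have hwW : w ∈ W := ⟨hw, fun r hr => hcon r hr⟩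
  rcases hch.2.1 with h | h
  · have := hwW.2 y hyR; tauto
  · exact h.1 hwW

open scoped Classical in
/-- **Pósa's lemma**. -/
theorem card_extNbrs_endpoints_lt {Γ : SimpleGraph V} {l₀ : List V} (h₀ : IsLongestPath Γ l₀)
    (hne : l₀ ≠ []) :
    (extNbrs Γ (endpoints Γ l₀).toFinset).card < 2 * (endpoints Γ l₀).toFinset.card := by
  set R := (endpoints Γ l₀).toFinset with hR
  set z := l₀.getLast hne with hz
  have hl₀ : l₀ = l₀.dropLast ++ [z] := (List.dropLast_append_getLast hne).symm
  have hzR : z ∈ R := by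
    rw [hR, Set.mem_toFinset]
    refine ⟨l₀.dropLast, ?_⟩
    rw [← hl₀]
    exact Rotated.refl
  set A : Finset V := Finset.univ.filter fun w => ∃ r ∈ R, Consec l₀ r w
  set B : Finset V := Finset.univ.filter fun w => ∃ r ∈ R, Consec l₀ w r
  have hsub : extNbrs Γ R ⊆ A ∪ B := by
    intro w hw
    simp only [extNbrs, Finset.mem_filter, Finset.mem_univ, true_and] at hw
    obtain ⟨hw, u, hu, huw⟩ := hw
    rw [hR, Set.mem_toFinset] at hw hu
    obtain ⟨r, hr, h⟩ := exists_consec_of_adj_endpoint h₀ hu hw huw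
    have hr' : r ∈ R := by rw [hR, Set.mem_toFinset]; exact hr
    simp only [A, B, Finset.mem_union, Finset.mem_filter, Finset.mem_univ, true_and]
    rcases h with h | h
    · exact Or.inl ⟨r, hr', h⟩
    · exact Or.inr ⟨r, hr', h⟩
  -- The last vertex z is an endpoint without a successor; this saves the one that makes Pósa's
  -- inequality strict.
  have hA : A.card ≤ (R.erase z).card := by
    have hex : ∀ w, ∃ r, w ∈ A → r ∈ R ∧ Consec l₀ r w := by
      intro w
      by_cases hw : w ∈ A
      · obtain ⟨r, hr⟩ := (Finset.mem_filter.1 hw).2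
        exact ⟨r, fun _ => hr⟩
      · exact ⟨w, fun h => absurd h hw⟩
    choose f hf using hex
    refine Finset.card_le_card_of_injOn f (fun w hw => ?_) (fun w hw w' hw' h => ?_)
    · have := hf w hw
      refine Finset.mem_erase.2 ⟨fun hfz => ?_, this.1⟩
      obtain ⟨i, hi, h1, h2⟩ := this.2
      rw [hfz, hz, List.getLast_eq_getElem] at h1
      have := (h₀.nodup.getElem_inj_iff).1 h1
      omega
    · have h1 := (hf w hw).2
      rw [h] at h1
      exact h1.eq_right h₀.nodup (hf w' hw').2
  have hB : B.card ≤ R.card := by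
    have hex : ∀ w, ∃ r, w ∈ B → r ∈ R ∧ Consec l₀ w r := by
      intro w
      by_cases hw : w ∈ B
      · obtain ⟨r, hr⟩ := (Finset.mem_filter.1 hw).2
        exact ⟨r, fun _ => hr⟩
      · exact ⟨w, fun h => absurd h hw⟩
    choose f hf using hex
    refine Finset.card_le_card_of_injOn f (fun w hw => (hf w hw).1) (fun w hw w' hw' h => ?_)
    have h1 := (hf w hw).2
    rw [h] at h1
    exact h1.eq_left h₀.nodup (hf w' hw').2
  have h1 := Finset.card_le_card hsub
  have h2 := Finset.card_union_le A B
  have h3 := Finset.card_erase_of_mem hzR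
  have h4 := Finset.card_pos.2 ⟨z, hzR⟩
  omega

/-- Every set of at most `k` vertices has at least twice as many outside neighbours. -/
def Expands (Γ : SimpleGraph V) (k : ℕ) : Prop :=
  ∀ S : Finset V, S.card ≤ k → 2 * S.card ≤ (extNbrs Γ S).card

open scoped Classical in
theorem Expands.lt_card_endpoints {Γ : SimpleGraph V} {k : ℕ} (hk : Expands Γ k) {l₀ : List V}
    (h₀ : IsLongestPath Γ l₀) (hne : l₀ ≠ []) : k < (endpoints Γ l₀).toFinset.card := by
  by_contra! h
  have h1 := hk _ h
  have h2 := card_extNbrs_endpoints_lt h₀ hne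
  omega

/-- Pairs of end vertices of longest paths. -/
def IsLongestPair (Γ : SimpleGraph V) (v y : V) : Prop :=
  ∃ l, IsLongestPath Γ l ∧ l.head? = some v ∧ l.getLast? = some y

omit [Fintype V] in
theorem isLongestPair_of_mem_endpoints {Γ : SimpleGraph V} {l₀ : List V} (h₀ : IsLongestPath Γ l₀)
    {x v : V} (hx : l₀.head? = some x) (hv : v ∈ endpoints Γ l₀) : IsLongestPair Γ x v := by
  obtain ⟨l, hl⟩ := hv
  exact ⟨_, hl.isLongestPath h₀, by rw [hl.head?, hx], by simp⟩

omit [Fintype V] in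
theorem IsLongestPath.reverse {Γ : SimpleGraph V} {l : List V} (h : IsLongestPath Γ l) :
    IsLongestPath Γ l.reverse :=
  ⟨h.toIsPathList.reverse, fun l' hl' => by simpa using h.longest l' hl'⟩

theorem exists_isLongestPath [Nonempty V] (Γ : SimpleGraph V) :
    ∃ l, IsLongestPath Γ l ∧ l ≠ [] := by
  classical
  let P : ℕ → Prop := fun m => ∃ l, IsPathList Γ l ∧ l.length = m
  have hbound : ∀ m, P m → m ≤ Fintype.card V := by
    rintro m ⟨l, hl, rfl⟩
    exact hl.nodup.length_le_card
  have hP1 : P 1 := ⟨[Classical.arbitrary V], ⟨by simp, by simp⟩, rfl⟩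
  have h1 : 1 ≤ Fintype.card V := hbound 1 hP1
  obtain ⟨l, hl, hlen⟩ := Nat.findGreatest_spec (P := P) h1 hP1
  refine ⟨l, ⟨hl, fun l' hl' => ?_⟩, ?_⟩
  · rw [hlen]
    exact Nat.le_findGreatest (hbound _ ⟨l', hl', rfl⟩) ⟨l', hl', rfl⟩
  · rintro rfl
    have := Nat.le_findGreatest (P := P) h1 hP1
    simp at hlen
    omega

open scoped Classical in
-- Rotating one longest path gives more than k end vertices v. Reversing each resulting path and
-- rotating again with v fixed gives more than k partners. The pairs are ordered.
theorem Expands.card_longestPairs [Nonempty V] {Γ : SimpleGraph V} {k : ℕ} (hk : Expands Γ k) :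
    (k + 1) ^ 2 ≤ (Finset.univ.filter fun q : V × V => IsLongestPair Γ q.1 q.2).card := by
  obtain ⟨l₀, h₀, hne⟩ := exists_isLongestPath Γ
  obtain ⟨x, hx⟩ : ∃ x, l₀.head? = some x := by
    cases l₀ with
    | nil => exact absurd rfl hne
    | cons x t => exact ⟨x, rfl⟩
  have hR := hk.lt_card_endpoints h₀ hne
  have hfib : ∀ v ∈ (endpoints Γ l₀).toFinset,
      k + 1 ≤ (Finset.univ.filter fun y : V => IsLongestPair Γ v y).card := by
    intro v hv
    rw [Set.mem_toFinset] at hv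
    obtain ⟨l, hl, h1, h2⟩ := isLongestPair_of_mem_endpoints h₀ hx hv
    have hl' := hl.reverse
    have hne' : l.reverse ≠ [] := by
      rintro h
      rw [List.reverse_eq_nil_iff] at h
      subst h; simp at h1
    have := hk.lt_card_endpoints hl' hne'
    refine this.trans_le (Finset.card_le_card fun y hy => ?_)
    rw [Set.mem_toFinset] at hy
    simp only [Finset.mem_filter, Finset.mem_univ, true_and]
    exact isLongestPair_of_mem_endpoints hl' (by simpa using h2) hy
  calc (k + 1) ^ 2 = (k + 1) * (k + 1) := sq _
    _ ≤ (endpoints Γ l₀).toFinset.card * (k + 1) := Nat.mul_le_mul_right _ hR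
    _ = ∑ v ∈ (endpoints Γ l₀).toFinset, (k + 1) := by simp
    _ ≤ ∑ v ∈ (endpoints Γ l₀).toFinset,
          (Finset.univ.filter fun y : V => IsLongestPair Γ v y).card := Finset.sum_le_sum hfib
    _ ≤ ∑ v : V, (Finset.univ.filter fun y : V => IsLongestPair Γ v y).card :=
        Finset.sum_le_sum_of_subset (Finset.subset_univ _)
    _ = _ := by
        simp only [Finset.card_filter, Fintype.sum_prod_type]

end Posa

/-! ### Boosters, and completing an expander to a Hamilton cycle -/

section Boosters

variable {V : Type*} [Fintype V]

theorem isHamiltonian_of_isPathList [DecidableEq V] {Γ : SimpleGraph V} {l : List V}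
    (h : IsPathList Γ l) (hlen : l.length = Fintype.card V) (hV : 3 ≤ Fintype.card V) {v y : V}
    (hv : l.head? = some v) (hy : l.getLast? = some y) (hadj : Γ.Adj y v) : Γ.IsHamiltonian := by
  intro _
  have hne : l ≠ [] := by rintro rfl; simp at hv
  have hv' : l.head hne = v := by
    rw [List.head?_eq_some_head hne] at hv; exact Option.some.inj hv
  have hy' : l.getLast hne = y := by
    rw [List.getLast?_eq_some_getLast hne] at hy; exact Option.some.inj hy
  subst hv'; subst hy'
  let p := SimpleGraph.Walk.ofSupport l hne h.chain
  have hs : p.support = l := SimpleGraph.Walk.support_ofSupport hne h.chain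
  have hp : p.IsPath := by rw [SimpleGraph.Walk.isPath_def, hs]; exact h.nodup
  have hpl : p.length = l.length - 1 := SimpleGraph.Walk.length_ofSupport hne h.chain
  refine ⟨_, SimpleGraph.Walk.cons hadj p, ?_⟩
  rw [SimpleGraph.Walk.isHamiltonianCycle_iff_isCycle_and_length_eq]
  refine ⟨?_, by rw [SimpleGraph.Walk.length_cons, hpl]; omega⟩
  rw [SimpleGraph.Walk.isCycle_iff_isPath_tail_and_le_length]
  refine ⟨by simpa using hp, by rw [SimpleGraph.Walk.length_cons, hpl]; omega⟩

omit [Fintype V] in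
-- The edge between the ends closes the path to a cycle; opening the cycle at z and attaching w
-- gains a vertex.
theorem exists_longer_of_adj {Γ : SimpleGraph V} {l : List V} (h : IsPathList Γ l) {v y z w : V}
    (hv : l.head? = some v) (hy : l.getLast? = some y) (hadj : Γ.Adj y v) (hz : z ∈ l) (hw : w ∉ l)
    (hwz : Γ.Adj w z) : ∃ l', IsPathList Γ l' ∧ l.length < l'.length := by
  obtain ⟨a, b, rfl⟩ := List.append_of_mem hz
  have hch := List.isChain_append.1 h.chain
  refine ⟨w :: ((z :: b) ++ a), ⟨?_, ?_⟩, by simp; omega⟩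
  · rw [List.cons_append, List.isChain_cons_cons, ← List.cons_append, List.isChain_append]
    refine ⟨hwz, hch.2.1, hch.1, fun x hx t ht => ?_⟩
    have hx' : x = y := by
      rw [List.getLast?_append_of_ne_nil _ (by simp)] at hy
      rw [hy] at hx
      exact (Option.some.inj hx).symm
    have ht' : t = v := by
      cases a with
      | nil => simp at ht
      | cons c a => 
        simp only [List.head?_cons, Option.mem_def, List.cons_append] at ht hv
        rw [ht] at hv
        exact Option.some.inj hv
    rw [hx', ht']; exact hadj
  · have hperm : ((z :: b) ++ a).Perm (a ++ z :: b) := List.perm_append_comm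
    rw [List.nodup_cons, hperm.nodup_iff]
    exact ⟨fun hmem => hw (hperm.mem_iff.1 hmem), h.nodup⟩

open scoped Classical in
/-- The edges of a finite graph. -/
noncomputable def edges (G : SimpleGraph V) : Finset (Sym2 V) :=
  Finset.univ.filter fun e => e ∈ G.edgeSet

@[simp] theorem mem_edges {G : SimpleGraph V} {e : Sym2 V} : e ∈ edges G ↔ e ∈ G.edgeSet := by
  simp [edges]

theorem coe_edges (G : SimpleGraph V) : (edges G : Set (Sym2 V)) = G.edgeSet := by
  ext; simp

theorem edges_mono {G H : SimpleGraph V} (h : G ≤ H) : edges G ⊆ edges H := by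
  intro e he
  rw [mem_edges] at he ⊢
  exact SimpleGraph.edgeSet_mono h he

theorem ncard_edgeSet (G : SimpleGraph V) : G.edgeSet.ncard = (edges G).card := by
  rw [← coe_edges, Set.ncard_coe_finset]

/-- Every nonempty proper set of vertices is left by an edge. -/
def NoCut (Γ : SimpleGraph V) : Prop :=
  ∀ S : Finset V, S.Nonempty → S ≠ Finset.univ → ∃ u ∈ S, ∃ w ∉ S, Γ.Adj u w

theorem NoCut.mono {Γ Γ' : SimpleGraph V} (h : Γ ≤ Γ') (hΓ : NoCut Γ) : NoCut Γ' := by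
  intro S h1 h2
  obtain ⟨u, hu, w, hw, huw⟩ := hΓ S h1 h2
  exact ⟨u, hu, w, hw, h huw⟩

theorem Expands.mono {Γ Γ' : SimpleGraph V} {k : ℕ} (h : Γ ≤ Γ') (hΓ : Expands Γ k) :
    Expands Γ' k := by
  intro S hS
  refine (hΓ S hS).trans (Finset.card_le_card fun v hv => ?_)
  simp only [extNbrs, Finset.mem_filter, Finset.mem_univ, true_and] at hv ⊢
  obtain ⟨h1, u, hu, huv⟩ := hv
  exact ⟨h1, u, hu, h huv⟩

theorem isHamiltonian_or_exists_longer [DecidableEq V] {Γ Γ' : SimpleGraph V} (hle : Γ ≤ Γ')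
    (hcut : NoCut Γ) (hV : 3 ≤ Fintype.card V) {l : List V} (hl : IsLongestPath Γ l) {v y : V}
    (hv : l.head? = some v) (hy : l.getLast? = some y) (hadj : Γ'.Adj y v) :
    Γ'.IsHamiltonian ∨ ∃ l', IsPathList Γ' l' ∧ l.length < l'.length := by
  have hl' : IsPathList Γ' l := ⟨hl.chain.imp fun a b hab => hle hab, hl.nodup⟩
  by_cases hall : l.toFinset = Finset.univ
  · left
    refine isHamiltonian_of_isPathList hl' ?_ hV hv hy hadj
    rw [← List.toFinset_card_of_nodup hl.nodup, hall, Finset.card_univ]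
  · right
    have hne : l.toFinset.Nonempty := by
      refine ⟨v, ?_⟩
      rw [List.mem_toFinset]
      exact List.mem_of_mem_head? hv
    obtain ⟨z, hz, w, hw, hzw⟩ := hcut _ hne hall
    rw [List.mem_toFinset] at hz hw
    exact exists_longer_of_adj hl' hv hy hadj hz hw (hle hzw.symm)

open scoped Classical in
/-- The non-edges of `Γ` that, once added, create a Hamiltonian cycle or a longer path. -/
noncomputable def boosters [DecidableEq V] (Γ : SimpleGraph V) : Finset (Sym2 V) :=
  Finset.univ.filter fun e => ¬ e.IsDiag ∧ e ∉ Γ.edgeSet ∧ ∀ Γ', Γ ≤ Γ' → e ∈ Γ'.edgeSet →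
    Γ'.IsHamiltonian ∨ ∃ l', IsPathList Γ' l' ∧ ∀ l, IsPathList Γ l → l.length < l'.length

/-- Joining the two ends of a longest path gives a Hamilton cycle or, since no edge cut is empty, a
longer path. Each unordered pair of ends comes from at most two ordered ones, whence the factor 2.
-/
theorem Expands.card_boosters [DecidableEq V] {Γ : SimpleGraph V} {k : ℕ} (hk : Expands Γ k)
    (hcut : NoCut Γ) (hV : 3 ≤ Fintype.card V) (hΓ : ¬ Γ.IsHamiltonian) :
    (k + 1) ^ 2 ≤ 2 * (boosters Γ).card := by
  classical
  have : Nonempty V := Fintype.card_pos_iff.1 (by omega)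
  refine hk.card_longestPairs.trans ?_
  refine Finset.card_le_mul_card_image_of_maps_to (f := fun q : V × V => s(q.1, q.2)) ?_ 2 ?_
  · rintro ⟨v, y⟩ hq
    simp only [Finset.mem_filter, Finset.mem_univ, true_and] at hq
    obtain ⟨l, hl, hv, hy⟩ := hq
    simp only [boosters, Finset.mem_filter, Finset.mem_univ, true_and, Sym2.mk_isDiag_iff,
      SimpleGraph.mem_edgeSet]
    refine ⟨?_, fun hadj => ?_, fun Γ' hle hadj => ?_⟩
    -- Equal ends would mean a longest path on a single vertex, but there is an edge, hence a path
    -- on two vertices.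
    · rintro rfl
      obtain ⟨u, hu, w, hw, huw⟩ := hcut {v} (by simp) (by
        intro h
        have := congrArg Finset.card h
        rw [Finset.card_singleton, Finset.card_univ] at this
        omega)
      have h2 := hl.longest [u, w] ⟨by simpa using huw, by simpa using huw.ne⟩
      obtain ⟨a, t, rfl⟩ : ∃ a t, l = a :: t := by
        cases l with
        | nil => simp at hv
        | cons a t => exact ⟨a, t, rfl⟩
      have ht : t ≠ [] := by rintro rfl; simp at h2
      rw [List.getLast?_cons_of_ne_nil ht] at hy
      have hmem : v ∈ t := List.mem_of_mem_getLast? hy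
      simp only [List.head?_cons, Option.some.injEq] at hv
      subst hv
      exact (List.nodup_cons.1 hl.nodup).1 hmem
    · rcases isHamiltonian_or_exists_longer le_rfl hcut hV hl hv hy hadj.symm with h | ⟨l', h1, h2⟩
      · exact hΓ h
      · exact absurd (hl.longest l' h1) (by omega)
    · rcases isHamiltonian_or_exists_longer hle hcut hV hl hv hy hadj.symm with h | ⟨l', h1, h2⟩
      · exact Or.inl h
      · exact Or.inr ⟨l', h1, fun l'' hl'' => (hl.longest l'' hl'').trans_lt h2⟩
  · intro e _
    induction e with
    | h x y =>
      refine (Finset.card_le_card (t := {(x, y), (y, x)}) ?_).trans Finset.card_le_two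
      rintro ⟨v, w⟩ h
      simp only [Finset.mem_filter, Sym2.eq_iff] at h
      simp only [Finset.mem_insert, Finset.mem_singleton, Prod.mk.injEq]
      tauto

/-- If every sparse expander inside `G` has a booster in `G`, then a sparser expander in `G` can be
completed to a Hamilton cycle. -/
theorem isHamiltonian_of_boosters [DecidableEq V] {G Γ : SimpleGraph V} {k M : ℕ}
    (hV : 3 ≤ Fintype.card V) (hle : Γ ≤ G) (hk : Expands Γ k) (hcut : NoCut Γ)
    (hM : (edges Γ).card + Fintype.card V ≤ M)
    (hboost : ∀ Γ' ≤ G, (edges Γ').card ≤ M → (k + 1) ^ 2 ≤ 2 * (boosters Γ').card →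
      ∃ e ∈ boosters Γ', e ∈ G.edgeSet) : G.IsHamiltonian := by
  by_contra hG
  -- After m boosters there is a path on at least m vertices, so the process cannot survive to m =
  -- |V| + 1. At most |V| edges have been added whenever a booster is sought, which is the slack
  -- left in `hM`.
  have key : ∀ m ≤ Fintype.card V + 1, ∃ Γ' ≤ G, Γ ≤ Γ' ∧ (edges Γ').card ≤ (edges Γ).card + m ∧
      ∃ l, IsPathList Γ' l ∧ m ≤ l.length := by
    intro m
    induction m with
    | zero => exact fun _ => ⟨Γ, hle, le_rfl, by omega, [], ⟨by simp, by simp⟩, by simp⟩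
    | succ m ih =>
      intro hm
      obtain ⟨Γ', h1, h2, h3, l, hl, hml⟩ := ih (by omega)
      have hnot : ¬ Γ'.IsHamiltonian := fun h => hG (h.mono h1)
      have hb := (hk.mono h2).card_boosters (hcut.mono h2) hV hnot
      obtain ⟨e, he, heG⟩ := hboost Γ' h1 (by omega) hb
      simp only [boosters, Finset.mem_filter, Finset.mem_univ, true_and] at he
      have hle' : Γ' ⊔ SimpleGraph.fromEdgeSet {e} ≤ G := by
        refine sup_le h1 ?_
        rw [← SimpleGraph.fromEdgeSet_edgeSet G]
        exact SimpleGraph.fromEdgeSet_mono (by simpa using heG)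
      have hset : (Γ' ⊔ SimpleGraph.fromEdgeSet {e}).edgeSet = insert e Γ'.edgeSet := by
        rw [SimpleGraph.edgeSet_sup, SimpleGraph.edgeSet_fromEdgeSet]
        ext x
        simp only [Set.mem_union, Set.mem_sdiff, Set.mem_singleton_iff, Set.mem_insert_iff]
        constructor
        · tauto
        · rintro (rfl | h)
          · exact Or.inr ⟨rfl, he.1⟩
          · exact Or.inl h
      rcases he.2.2 _ le_sup_left (by rw [hset]; exact Set.mem_insert _ _) with h | ⟨l', hl', hlt⟩
      · exact absurd (h.mono hle') hG
      · refine ⟨_, hle', h2.trans le_sup_left, ?_, l', hl', ?_⟩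
        · have : edges (Γ' ⊔ SimpleGraph.fromEdgeSet {e}) ⊆ insert e (edges Γ') := by
            intro x hx
            rw [mem_edges, hset] at hx
            rw [Finset.mem_insert, mem_edges]
            exact hx
          have := Finset.card_le_card this
          have := Finset.card_insert_le e (edges Γ')
          omega
        · have := hlt l hl
          omega
  obtain ⟨Γ', _, _, _, l, hl, hlen⟩ := key _ le_rfl
  have := hl.nodup.length_le_card
  omega

end Boosters

/-! ### Sparse expanders inside a graph whose low-degree vertices are far apart -/

section SparseExpander

variable {V : Type*} [Fintype V]

open scoped Classical in
/-- The neighbourhood of a vertex of a finite graph. -/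
noncomputable def nbrs (G : SimpleGraph V) (v : V) : Finset V := Finset.univ.filter (G.Adj v)

@[simp] theorem mem_nbrs {G : SimpleGraph V} {v w : V} : w ∈ nbrs G v ↔ G.Adj v w := by
  simp [nbrs]

@[simp] theorem mem_extNbrs {Γ : SimpleGraph V} {S : Finset V} {v : V} :
    v ∈ extNbrs Γ S ↔ v ∉ S ∧ ∃ u ∈ S, Γ.Adj u v := by
  simp [extNbrs]

/-- Two vertices are joined by a walk of length at most four. -/
def Close (G : SimpleGraph V) (u v : V) : Prop :=
  ∃ a b c, (G.Adj u a ∨ u = a) ∧ (G.Adj a b ∨ a = b) ∧ (G.Adj b c ∨ b = c) ∧ (G.Adj c v ∨ c = v)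

omit [Fintype V] in
theorem Close.mono {G G' : SimpleGraph V} (h : G ≤ G') {u v : V} (hc : Close G u v) :
    Close G' u v := by
  obtain ⟨a, b, c, h1, h2, h3, h4⟩ := hc
  exact ⟨a, b, c, h1.imp_left (@h _ _), h2.imp_left (@h _ _), h3.imp_left (@h _ _),
    h4.imp_left (@h _ _)⟩

/-- No edge joins S to the complement of S ∪ N(S). If s < |S| ≤ |V|/4 and |N(S)| < 2|S|, both sides
have at least s vertices, against `hhit`. For cuts, either one side is small and expands, or both
sides are large. -/
theorem expands_and_noCut {Γ : SimpleGraph V} {s : ℕ} (hs : 1 ≤ s) (hsn : 4 * s ≤ Fintype.card V)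
    (hsmall : Expands Γ s)
    (hhit : ∀ A B : Finset V, Disjoint A B → s ≤ A.card → s ≤ B.card →
      ∃ a ∈ A, ∃ b ∈ B, Γ.Adj a b) :
    Expands Γ (Fintype.card V / 4) ∧ NoCut Γ := by
  classical
  constructor
  · intro S hS
    by_cases hSs : S.card ≤ s
    · exact hsmall S hSs
    · by_contra! hcon
      have hdisj : Disjoint S (S ∪ extNbrs Γ S)ᶜ := by
        rw [Finset.disjoint_left]
        intro x hx hx'
        simp [hx] at hx'
      have hd2 : Disjoint S (extNbrs Γ S) := by
        rw [Finset.disjoint_left]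
        intro x hx hx'
        simp [hx] at hx'
      have hcard : (S ∪ extNbrs Γ S)ᶜ.card = Fintype.card V - (S.card + (extNbrs Γ S).card) := by
        rw [Finset.card_compl, Finset.card_union_of_disjoint hd2]
      obtain ⟨a, ha, b, hb, hab⟩ := hhit S _ hdisj (by omega) (by omega : s ≤ _)
      apply Finset.mem_compl.1 hb
      rw [Finset.mem_union, mem_extNbrs]
      by_cases hbS : b ∈ S
      · exact Or.inl hbS
      · exact Or.inr ⟨hbS, a, ha, hab⟩
  · intro S hne huniv
    have hex : ∀ T : Finset V, T.Nonempty → T.card ≤ s → ∃ u ∈ T, ∃ w ∉ T, Γ.Adj u w := by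
      intro T hT hTs
      have h1 := hsmall T hTs
      have h2 := Finset.card_pos.2 hT
      obtain ⟨w, hw⟩ := Finset.card_pos.1 (by omega : 0 < (extNbrs Γ T).card)
      obtain ⟨hw, u, hu, huw⟩ := mem_extNbrs.1 hw
      exact ⟨u, hu, w, hw, huw⟩
    by_cases h1 : S.card ≤ s
    · exact hex S hne h1
    by_cases h2 : Sᶜ.card ≤ s
    · have hne' : Sᶜ.Nonempty := by
        rw [Finset.nonempty_iff_ne_empty]
        intro h
        exact huniv (Finset.compl_eq_empty_iff S |>.1 h)
      obtain ⟨u, hu, w, hw, huw⟩ := hex _ hne' h2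
      exact ⟨w, by simpa using hw, u, by simpa using hu, huw.symm⟩
    · obtain ⟨a, ha, b, hb, hab⟩ := hhit S Sᶜ disjoint_compl_right (by omega) (by omega)
      exact ⟨a, ha, b, by simpa using hb, hab⟩

theorem card_le_two_mul_card_edges {F : SimpleGraph V} [DecidableEq V] {C : V → Finset V}
    {U S : Finset V} {D : ℕ} (hSU : S ⊆ U) (hC : ∀ v ∈ S, D ≤ (C v).card)
    (hCU : ∀ v ∈ S, ∀ w ∈ C v, w ∈ U ∧ F.Adj v w) :
    D * S.card ≤ 2 * (edges F ∩ U.sym2).card := by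
  calc D * S.card = ∑ v ∈ S, D := by simp [mul_comm]
    _ ≤ ∑ v ∈ S, (C v).card := Finset.sum_le_sum hC
    _ = (S.sigma C).card := (Finset.card_sigma _ _).symm
    _ ≤ _ := by
      refine Finset.card_le_mul_card_image_of_maps_to
        (f := fun q : (_ : V) × V => s(q.1, q.2)) ?_ 2 ?_
      · rintro ⟨v, w⟩ h
        rw [Finset.mem_sigma] at h
        have := hCU v h.1 w h.2
        rw [Finset.mem_inter, mem_edges, SimpleGraph.mem_edgeSet, Finset.mk_mem_sym2_iff]
        exact ⟨this.2, hSU h.1, this.1⟩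
      · intro e _
        induction e with
        | h x y =>
          refine (Finset.card_le_card (t := {⟨x, y⟩, ⟨y, x⟩}) ?_).trans Finset.card_le_two
          rintro ⟨v, w⟩ h
          simp only [Finset.mem_filter, Sym2.eq_iff] at h
          simp only [Finset.mem_insert, Finset.mem_singleton, Sigma.mk.injEq, heq_eq_eq]
          tauto

/-- Split S into S1, of degree below D in F, and S2. The vertices of S1 have disjoint pairs T of
neighbours, giving a set X of size 2|S1|. Sparsity forces S2 to have at least 6|S2| outside
neighbours. The distance condition bounds the overlap of the two contributions. -/
theorem expands_of_choice {Γ F : SimpleGraph V} [DecidableEq V] {C : V → Finset V} {D s : ℕ}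
    (hD : 2 ≤ D) (hΓF : Γ ≤ F) (hdeg : ∀ v, 2 ≤ (nbrs F v).card)
    (hC : ∀ v, (C v).card = min (nbrs F v).card D) (hCΓ : ∀ v, ∀ w ∈ C v, Γ.Adj v w)
    (hfar : ∀ u v, u ≠ v → (nbrs F u).card < D → (nbrs F v).card < D → ¬ Close F u v)
    (hsp : ∀ U : Finset V, U.Nonempty → U.card ≤ 7 * s →
      14 * (edges F ∩ U.sym2).card < D * U.card) :
    Expands Γ s := by
  classical
  intro S hS
  have hC2 : ∀ v, 2 ≤ (C v).card := fun v => by rw [hC]; exact le_min (hdeg v) hD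
  have hexT : ∀ v, ∃ T ⊆ C v, T.card = 2 := fun v => Finset.exists_subset_card_eq (hC2 v)
  choose T hTC hT2 using hexT
  have hTF : ∀ v, ∀ w ∈ T v, F.Adj v w := fun v w hw => hΓF (hCΓ v w (hTC v hw))
  set S1 := S.filter fun v => (nbrs F v).card < D with hS1
  set S2 := S.filter fun v => ¬ (nbrs F v).card < D with hS2
  have hS12 : S1.card + S2.card = S.card := Finset.card_filter_add_card_filter_not _
  have hfar' : ∀ u ∈ S1, ∀ v ∈ S1, Close F u v → u = v := by
    intro u hu v hv hc
    by_contra hne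
    exact hfar u v hne (Finset.mem_filter.1 hu).2 (Finset.mem_filter.1 hv).2 hc
  set X := S1.biUnion T with hX
  -- A common neighbour would put two low-degree vertices at distance at most two.
  have hXcard : X.card = 2 * S1.card := by
    rw [hX, Finset.card_biUnion]
    · simp [hT2, mul_comm]
    · intro u hu v hv huv
      rw [Function.onFun, Finset.disjoint_left]
      intro t ht ht'
      exact huv (hfar' u hu v hv ⟨t, v, v, Or.inl (hTF u t ht), Or.inl (hTF v t ht').symm,
        Or.inr rfl, Or.inr rfl⟩)
  have hXS1 : ∀ x ∈ X, x ∉ S1 := by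
    intro x hx hx1
    obtain ⟨v, hv, hxv⟩ := Finset.mem_biUnion.1 hx
    have hadj := hTF v x hxv
    exact hadj.ne (hfar' v hv x hx1 ⟨x, x, x, Or.inl hadj, Or.inr rfl, Or.inr rfl, Or.inr rfl⟩)
  -- Otherwise U = S2 ∪ N(S2) has fewer than 7|S2| vertices but spans at least D|S2|/2 edges of F,
  -- which contradicts `hsp`.
  have hE2 : 6 * S2.card ≤ (extNbrs Γ S2).card := by
    by_contra! hlt
    have hdisj : Disjoint S2 (extNbrs Γ S2) := by
      rw [Finset.disjoint_left]
      intro x hx hx'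
      exact (mem_extNbrs.1 hx').1 hx
    have hUcard : (S2 ∪ extNbrs Γ S2).card = S2.card + (extNbrs Γ S2).card :=
      Finset.card_union_of_disjoint hdisj
    have hne : (S2 ∪ extNbrs Γ S2).Nonempty := by
      rw [← Finset.card_pos]; omega
    have h1 := hsp _ hne (by omega)
    have h2 : D * S2.card ≤ 2 * (edges F ∩ (S2 ∪ extNbrs Γ S2).sym2).card := by
      refine card_le_two_mul_card_edges (C := C) Finset.subset_union_left ?_ ?_
      · intro v hv
        have := (Finset.mem_filter.1 hv).2
        rw [hC]; exact le_min (by omega) le_rfl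
      · intro v hv w hw
        refine ⟨?_, hΓF (hCΓ v w hw)⟩
        rw [Finset.mem_union, mem_extNbrs]
        by_cases hw2 : w ∈ S2
        · exact Or.inl hw2
        · exact Or.inr ⟨hw2, v, hv, hCΓ v w hw⟩
    have h3 : D * (S2 ∪ extNbrs Γ S2).card ≤ D * (7 * S2.card) :=
      Nat.mul_le_mul_left _ (by omega)
    have h4 : D * (7 * S2.card) = 7 * (D * S2.card) := by ring
    omega
  set Y := S1 ∪ X with hY
  have hYrep : ∀ y ∈ Y, ∃ w ∈ S1, y ∈ insert w (T w) := by
    intro y hy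
    rcases Finset.mem_union.1 hy with h | h
    · exact ⟨y, h, Finset.mem_insert_self _ _⟩
    · obtain ⟨v, hv, hyv⟩ := Finset.mem_biUnion.1 h
      exact ⟨v, hv, Finset.mem_insert_of_mem hyv⟩
  have hstep : ∀ w y, y ∈ insert w (T w) → F.Adj w y ∨ w = y := by
    intro w y hy
    rcases Finset.mem_insert.1 hy with h | h
    · exact Or.inr h.symm
    · exact Or.inl (hTF w y h)
  -- Two neighbours y, y' of v in Y belong to clusters {w} ∪ T w and {w'} ∪ T w'. The walk w, y, v,
  -- y', w' has length at most four, so w = w'; this is why `Close` allows four steps.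
  have hYv : ∀ v, (Y.filter fun y => Γ.Adj v y).card ≤ 3 := by
    intro v
    rcases (Y.filter fun y => Γ.Adj v y).eq_empty_or_nonempty with h | ⟨y, hy⟩
    · simp [h]
    · obtain ⟨hyY, hvy⟩ := Finset.mem_filter.1 hy
      obtain ⟨w, hw, hyw⟩ := hYrep y hyY
      have hsub : (Y.filter fun y => Γ.Adj v y) ⊆ insert w (T w) := by
        intro y' hy'
        obtain ⟨hyY', hvy'⟩ := Finset.mem_filter.1 hy'
        obtain ⟨w', hw', hyw'⟩ := hYrep y' hyY'
        have : w = w' := hfar' w hw w' hw' ⟨y, v, y', hstep w y hyw, Or.inl (hΓF hvy).symm,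
          Or.inl (hΓF hvy'), (hstep w' y' hyw').imp (fun h => h.symm) Eq.symm⟩
        rw [this]; exact hyw'
      have h1 := Finset.card_le_card hsub
      have h2 := Finset.card_insert_le w (T w)
      have h3 := hT2 w
      omega
  have hZ : (extNbrs Γ S2 ∩ Y).card ≤ 3 * S2.card := by
    have hsub : extNbrs Γ S2 ∩ Y ⊆ S2.biUnion fun v => Y.filter fun y => Γ.Adj v y := by
      intro y hy
      obtain ⟨h1, h2⟩ := Finset.mem_inter.1 hy
      obtain ⟨_, v, hv, hvy⟩ := mem_extNbrs.1 h1
      exact Finset.mem_biUnion.2 ⟨v, hv, Finset.mem_filter.2 ⟨h2, hvy⟩⟩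
    refine (Finset.card_le_card hsub).trans ?_
    rw [mul_comm]
    exact Finset.card_biUnion_le_card_mul _ _ _ fun v _ => hYv v
  have hsub : (X \ S2) ∪ (extNbrs Γ S2 \ Y) ⊆ extNbrs Γ S := by
    intro x hx
    rw [mem_extNbrs]
    rcases Finset.mem_union.1 hx with h | h
    · obtain ⟨h1, h2⟩ := Finset.mem_sdiff.1 h
      have h3 := hXS1 x h1
      obtain ⟨v, hv, hxv⟩ := Finset.mem_biUnion.1 h1
      refine ⟨fun hxS => ?_, v, (Finset.mem_filter.1 hv).1, hCΓ v x (hTC v hxv)⟩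
      by_cases hd : (nbrs F x).card < D
      · exact h3 (Finset.mem_filter.2 ⟨hxS, hd⟩)
      · exact h2 (Finset.mem_filter.2 ⟨hxS, hd⟩)
    · obtain ⟨h1, h2⟩ := Finset.mem_sdiff.1 h
      obtain ⟨h3, v, hv, hvx⟩ := mem_extNbrs.1 h1
      refine ⟨fun hxS => ?_, v, (Finset.mem_filter.1 hv).1, hvx⟩
      by_cases hd : (nbrs F x).card < D
      · exact h2 (Finset.mem_union_left _ (Finset.mem_filter.2 ⟨hxS, hd⟩))
      · exact h3 (Finset.mem_filter.2 ⟨hxS, hd⟩)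
  have hdisj : Disjoint (X \ S2) (extNbrs Γ S2 \ Y) := by
    rw [Finset.disjoint_left]
    intro x hx hx'
    exact (Finset.mem_sdiff.1 hx').2 (Finset.mem_union_right _ (Finset.mem_sdiff.1 hx).1)
  -- The balance is exact: (2|S1| - |S2|) + (6|S2| - 3|S2|) = 2|S|.
  have h1 := Finset.card_le_card hsub
  rw [Finset.card_union_of_disjoint hdisj] at h1
  have h2 := Finset.le_card_sdiff S2 X
  have h3 := Finset.card_sdiff_add_card_inter (extNbrs Γ S2) Y
  omega

/-- Γ is R together with min(deg, D) chosen edges of F at every vertex: the chosen edges make sets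
of at most s vertices expand, and R handles the large ones. -/
theorem exists_sparse_expander {F R : SimpleGraph V} [DecidableEq V] {D s : ℕ} (hD : 2 ≤ D)
    (hs : 1 ≤ s) (hsn : 4 * s ≤ Fintype.card V) (hRF : R ≤ F)
    (hdeg : ∀ v, 2 ≤ (nbrs F v).card)
    (hfar : ∀ u v, u ≠ v → (nbrs F u).card < D → (nbrs F v).card < D → ¬ Close F u v)
    (hsp : ∀ U : Finset V, U.Nonempty → U.card ≤ 7 * s →
      14 * (edges F ∩ U.sym2).card < D * U.card)
    (hhit : ∀ A B : Finset V, Disjoint A B → s ≤ A.card → s ≤ B.card →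
      ∃ a ∈ A, ∃ b ∈ B, R.Adj a b) :
    ∃ Γ ≤ F, (edges Γ).card ≤ (edges R).card + Fintype.card V * D ∧
      Expands Γ (Fintype.card V / 4) ∧ NoCut Γ := by
  classical
  have hexC : ∀ v, ∃ T ⊆ nbrs F v, T.card = min (nbrs F v).card D :=
    fun v => Finset.exists_subset_card_eq (min_le_left _ _)
  choose C hCF hC using hexC
  set E : Finset (Sym2 V) := Finset.univ.biUnion fun v => (C v).image fun w => s(v, w) with hE
  have hEF : ∀ e ∈ E, e ∈ F.edgeSet := by
    intro e he
    obtain ⟨v, _, hv⟩ := Finset.mem_biUnion.1 he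
    obtain ⟨w, hw, rfl⟩ := Finset.mem_image.1 hv
    exact mem_nbrs.1 (hCF v hw)
  set Γ := R ⊔ SimpleGraph.fromEdgeSet (E : Set (Sym2 V)) with hΓ
  have hle : Γ ≤ F := by
    refine sup_le hRF ?_
    rw [← SimpleGraph.fromEdgeSet_edgeSet F]
    exact SimpleGraph.fromEdgeSet_mono fun e he => hEF e (by simpa using he)
  have hCΓ : ∀ v, ∀ w ∈ C v, Γ.Adj v w := by
    intro v w hw
    rw [hΓ, SimpleGraph.sup_adj, SimpleGraph.fromEdgeSet_adj]
    refine Or.inr ⟨?_, (mem_nbrs.1 (hCF v hw)).ne⟩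
    rw [Finset.mem_coe]
    exact Finset.mem_biUnion.2 ⟨v, Finset.mem_univ _, Finset.mem_image_of_mem _ hw⟩
  refine ⟨Γ, hle, ?_, expands_and_noCut hs hsn
    (expands_of_choice hD hle hdeg hC hCΓ hfar hsp) ?_⟩
  · have hsub : edges Γ ⊆ edges R ∪ E := by
      intro e he
      rw [mem_edges, hΓ, SimpleGraph.edgeSet_sup, SimpleGraph.edgeSet_fromEdgeSet] at he
      rw [Finset.mem_union, mem_edges]
      rcases he with h | h
      · exact Or.inl h
      · exact Or.inr (by simpa using h.1)
    refine (Finset.card_le_card hsub).trans ((Finset.card_union_le _ _).trans ?_)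
    refine Nat.add_le_add_left ?_ _
    rw [← Finset.card_univ]
    refine Finset.card_biUnion_le_card_mul _ _ _ fun v _ => Finset.card_image_le.trans ?_
    rw [hC]; exact min_le_right _ _
  · intro A B hAB hA hB
    obtain ⟨a, ha, b, hb, hab⟩ := hhit A B hAB hA hB
    exact ⟨a, ha, b, hb, by rw [hΓ, SimpleGraph.sup_adj]; exact Or.inl hab⟩

end SparseExpander

/-! ### Small hitting sets by a greedy choice -/

section HittingSet

variable {α : Type*} [DecidableEq α]

/-- By averaging over E, some element lies in at least a proportion θ of the sets not yet hit.
Adding it multiplies the number of remaining sets by at most 1 - θ. -/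
theorem exists_card_filter_disjoint_le {E : Finset α} (hE : E.Nonempty)
    {𝓕 : Finset (Finset α)} {θ : ℝ} (hθ1 : θ ≤ 1)
    (h𝓕 : ∀ X ∈ 𝓕, X ⊆ E ∧ θ * E.card ≤ X.card) (k : ℕ) :
    ∃ R ⊆ E, R.card ≤ k ∧ ((𝓕.filter fun X => Disjoint R X).card : ℝ) ≤ (1 - θ) ^ k * 𝓕.card := by
  induction k with
  | zero => exact ⟨∅, by simp, by simp, by simp⟩
  | succ k ih =>
    obtain ⟨R, hRE, hRk, hR⟩ := ih
    set 𝓤 := 𝓕.filter fun X => Disjoint R X with h𝓤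
    have hsum : ∑ e ∈ E, ((𝓤.filter fun X => e ∉ X).card : ℝ) ≤
        ∑ e ∈ E, (1 - θ) * 𝓤.card := by
      have h1 : ∑ e ∈ E, ((𝓤.filter fun X => e ∉ X).card : ℝ) =
          ∑ X ∈ 𝓤, ((E.filter fun e => e ∉ X).card : ℝ) := by
        have := Finset.sum_card_bipartiteAbove_eq_sum_card_bipartiteBelow
          (s := E) (t := 𝓤) (fun e X => e ∉ X)
        exact_mod_cast this
      rw [h1, Finset.sum_const, nsmul_eq_mul]
      have h2 : ∀ X ∈ 𝓤, ((E.filter fun e => e ∉ X).card : ℝ) ≤ (1 - θ) * E.card := by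
        intro X hX
        obtain ⟨hXE, hXc⟩ := h𝓕 X (Finset.mem_filter.1 hX).1
        have h3 : (E.filter fun e => e ∉ X) = E \ X := by
          ext e; simp
        rw [h3, Finset.card_sdiff_of_subset hXE, Nat.cast_sub (Finset.card_le_card hXE)]
        linarith
      refine (Finset.sum_le_sum h2).trans (le_of_eq ?_)
      rw [Finset.sum_const, nsmul_eq_mul]; ring
    obtain ⟨e, he, hle⟩ := Finset.exists_le_of_sum_le hE hsum
    refine ⟨insert e R, Finset.insert_subset he hRE,
      (Finset.card_insert_le _ _).trans (by omega), ?_⟩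
    have hsub : (𝓕.filter fun X => Disjoint (insert e R) X) ⊆ 𝓤.filter fun X => e ∉ X := by
      intro X hX
      obtain ⟨h1, h2⟩ := Finset.mem_filter.1 hX
      rw [Finset.disjoint_insert_left] at h2
      exact Finset.mem_filter.2 ⟨Finset.mem_filter.2 ⟨h1, h2.2⟩, h2.1⟩
    calc ((𝓕.filter fun X => Disjoint (insert e R) X).card : ℝ)
        ≤ ((𝓤.filter fun X => e ∉ X).card : ℝ) := by exact_mod_cast Finset.card_le_card hsub
      _ ≤ (1 - θ) * 𝓤.card := hle
      _ ≤ (1 - θ) * ((1 - θ) ^ k * 𝓕.card) := mul_le_mul_of_nonneg_left hR (by linarith)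
      _ = (1 - θ) ^ (k + 1) * 𝓕.card := by ring

theorem exists_hitting_set {E : Finset α} (hE : E.Nonempty)
    {𝓕 : Finset (Finset α)} {θ : ℝ} (hθ1 : θ ≤ 1)
    (h𝓕 : ∀ X ∈ 𝓕, X ⊆ E ∧ θ * E.card ≤ X.card) {k : ℕ} (hk : (1 - θ) ^ k * 𝓕.card < 1) :
    ∃ R ⊆ E, R.card ≤ k ∧ ∀ X ∈ 𝓕, ∃ e ∈ R, e ∈ X := by
  obtain ⟨R, h1, h2, h3⟩ := exists_card_filter_disjoint_le hE hθ1 h𝓕 k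
  refine ⟨R, h1, h2, fun X hX => ?_⟩
  have h4 : (𝓕.filter fun X => Disjoint R X).card = 0 := by
    have := h3.trans_lt hk
    exact_mod_cast Nat.lt_one_iff.1 (by exact_mod_cast this)
  rw [Finset.card_eq_zero] at h4
  by_contra! hcon
  have : X ∈ 𝓕.filter fun X => Disjoint R X :=
    Finset.mem_filter.2 ⟨hX, Finset.disjoint_left.2 hcon⟩
  rw [h4] at this
  simp at this

end HittingSet

/-! ### Robust graphs stay Hamiltonian after deleting few edges -/

section Robust

variable {V : Type*} [Fintype V] [DecidableEq V]

/-- The pairs with one vertex in `A` and one in `B`. -/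
def crossing (A B : Finset V) : Finset (Sym2 V) := (A ×ˢ B).image fun q => s(q.1, q.2)

/-- The pseudorandom properties of `G` from which the resilience is read off. -/
structure IsRobust (G : SimpleGraph V) (D s M h : ℕ) (K E : ℝ) : Prop where
  far : ∀ u v, u ≠ v → (nbrs G u).card < 3 * D → (nbrs G v).card < 3 * D → ¬ Close G u v
  sparse : ∀ U : Finset V, U.Nonempty → U.card ≤ 7 * s →
    14 * (edges G ∩ U.sym2).card < D * U.card
  dense : ∀ A B : Finset V, Disjoint A B → s ≤ A.card → s ≤ B.card →
    K ≤ (edges G ∩ crossing A B).card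
  size : ((edges G).card : ℝ) ≤ E
  boost : ∀ Γ ≤ G, (edges Γ).card ≤ M → (Fintype.card V / 4 + 1) ^ 2 ≤ 2 * (boosters Γ).card →
    h < (edges G ∩ boosters Γ).card

theorem edges_sdiff (G H : SimpleGraph V) : edges (G \ H) = edges G \ edges H := by
  ext e
  simp [SimpleGraph.edgeSet_sdiff]

theorem card_nbrs_le_add (G H : SimpleGraph V) (v : V) :
    (nbrs G v).card ≤ (nbrs (G \ H) v).card + (nbrs H v).card := by
  refine (Finset.card_le_card fun w hw => ?_).trans (Finset.card_union_le _ _)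
  rw [Finset.mem_union, mem_nbrs, mem_nbrs, SimpleGraph.sdiff_adj]
  rw [mem_nbrs] at hw
  tauto

theorem card_image_nbrs (H : SimpleGraph V) (v : V) :
    ((nbrs H v).image fun w => s(v, w)).card = (nbrs H v).card :=
  Finset.card_image_of_injective _ fun _ _ hab => Sym2.congr_right.1 hab

theorem image_nbrs_subset (H : SimpleGraph V) (v : V) :
    ((nbrs H v).image fun w => s(v, w)) ⊆ edges H := by
  intro e he
  obtain ⟨w, hw, rfl⟩ := Finset.mem_image.1 he
  rw [mem_edges]
  exact mem_nbrs.1 hw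

theorem card_nbrs_le_card_edges (H : SimpleGraph V) (v : V) :
    (nbrs H v).card ≤ (edges H).card := by
  rw [← card_image_nbrs]
  exact Finset.card_le_card (image_nbrs_subset H v)

theorem card_nbrs_add_card_nbrs_le (H : SimpleGraph V) {u v : V} (huv : u ≠ v) :
    (nbrs H u).card + (nbrs H v).card ≤ (edges H).card + 1 := by
  rw [← card_image_nbrs H u, ← card_image_nbrs H v, ← Finset.card_union_add_card_inter]
  refine Nat.add_le_add (Finset.card_le_card
    (Finset.union_subset (image_nbrs_subset H u) (image_nbrs_subset H v))) ?_
  refine (Finset.card_le_card (t := {s(u, v)}) fun e he => ?_).trans (by simp)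
  obtain ⟨h1, h2⟩ := Finset.mem_inter.1 he
  obtain ⟨a, _, rfl⟩ := Finset.mem_image.1 h1
  obtain ⟨b, _, h3⟩ := Finset.mem_image.1 h2
  rw [Sym2.eq_iff] at h3
  rw [Finset.mem_singleton]
  rcases h3 with ⟨h, _⟩ | ⟨h, _⟩
  · exact absurd h.symm huv
  · rw [h]

/-- Each property of G passes to F = G \ H with a loss that the margins in `IsRobust` absorb. This
yields a sparse expander in F, and F contains the boosters needed to complete it. -/
theorem IsRobust.isHamiltonian_sdiff {G H : SimpleGraph V} {D s M h d k : ℕ} {K E θ : ℝ}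
    (hG : IsRobust G D s M h K E) (hV : 3 ≤ Fintype.card V) (hD : 2 ≤ D) (hs : 1 ≤ s)
    (hsn : 4 * s ≤ Fintype.card V) (hE : 2 * E ≤ Fintype.card V * h)
    (hθ0 : 0 ≤ θ) (hθ1 : θ ≤ 1) (hθ : θ * E ≤ K - h) (hk : (1 - θ) ^ k * 4 ^ Fintype.card V < 1)
    (hM : k + Fintype.card V * D + Fintype.card V ≤ M)
    (hd : ∀ v, d ≤ (nbrs G v).card) (hH : (edges H).card + 2 ≤ d) : (G \ H).IsHamiltonian := by
  classical
  set F := G \ H with hF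
  have hFG : F ≤ G := sdiff_le
  -- The minimum degree is at most the average degree, so d|V| ≤ 2E ≤ h|V|. Hence H has at most h
  -- edges.
  have hdh : d ≤ h := by
    have h1 : d * Fintype.card V ≤ 2 * (edges G).card := by
      have := card_le_two_mul_card_edges (F := G) (C := nbrs G) (D := d)
        (Finset.subset_univ (Finset.univ : Finset V)) (fun v _ => hd v)
        (fun v _ w hw => ⟨Finset.mem_univ _, mem_nbrs.1 hw⟩)
      rw [Finset.card_univ] at this
      exact this.trans (Nat.mul_le_mul_left _ (Finset.card_le_card Finset.inter_subset_left))
    have h2 : (d : ℝ) * Fintype.card V ≤ 2 * (edges G).card := by exact_mod_cast h1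
    have h3 : (Fintype.card V : ℝ) * d ≤ Fintype.card V * h := by linarith [hG.size]
    have h4 : (0 : ℝ) < Fintype.card V := by exact_mod_cast (by omega : 0 < Fintype.card V)
    exact_mod_cast le_of_mul_le_mul_left h3 h4
  have hdegF : ∀ v, 2 ≤ (nbrs F v).card := by
    intro v
    have h1 := card_nbrs_le_add G H v
    have h2 := card_nbrs_le_card_edges H v
    have h3 := hd v
    rw [← hF] at h1
    omega
  -- Let a, b be the degrees of u, v in H. They share at most one edge, so a + b ≤ d - 1. From d < D
  -- + a and d < D + b follows d < 2D, so both degrees in G are below D + d < 3D.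
  have hfar : ∀ u v, u ≠ v → (nbrs F u).card < D → (nbrs F v).card < D → ¬ Close F u v := by
    intro u v huv hu hv hc
    have hu1 := card_nbrs_le_add G H u
    have hv1 := card_nbrs_le_add G H v
    have hu2 := card_nbrs_le_card_edges H u
    have hv2 := card_nbrs_le_card_edges H v
    have huv2 := card_nbrs_add_card_nbrs_le H huv
    have hu3 := hd u
    have hv3 := hd v
    rw [← hF] at hu1 hv1
    exact hG.far u v huv (by omega) (by omega) (hc.mono hFG)
  have hsp : ∀ U : Finset V, U.Nonempty → U.card ≤ 7 * s →
      14 * (edges F ∩ U.sym2).card < D * U.card := by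
    intro U h1 h2
    refine lt_of_le_of_lt (Nat.mul_le_mul_left _ ?_) (hG.sparse U h1 h2)
    exact Finset.card_le_card (Finset.inter_subset_inter_right (edges_mono hFG))
  -- There are at most 4^|V| pairs (A, B). The sets to be hit are the edges of F between A and B.
  set P : Finset (Finset V × Finset V) := Finset.univ.filter fun q =>
    Disjoint q.1 q.2 ∧ s ≤ q.1.card ∧ s ≤ q.2.card with hP
  set 𝓕 : Finset (Finset (Sym2 V)) := P.image fun q => edges F ∩ crossing q.1 q.2 with h𝓕
  have h𝓕card : (𝓕.card : ℝ) ≤ 4 ^ Fintype.card V := by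
    have h1 : 𝓕.card ≤ 4 ^ Fintype.card V := by
      refine Finset.card_image_le.trans ((Finset.card_filter_le _ _).trans (le_of_eq ?_))
      rw [Finset.card_univ, Fintype.card_prod, Fintype.card_finset, ← mul_pow]
      norm_num
    exact_mod_cast h1
  have hFE : ((edges F).card : ℝ) ≤ E :=
    le_trans (by exact_mod_cast Finset.card_le_card (edges_mono hFG)) hG.size
  have hEne : (edges F).Nonempty := by
    have : Nonempty V := Fintype.card_pos_iff.1 (by omega)
    rw [← Finset.card_pos]
    have h1 := hdegF (Classical.arbitrary V)
    have h2 := card_nbrs_le_card_edges F (Classical.arbitrary V)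
    omega
  have h𝓕prop : ∀ X ∈ 𝓕, X ⊆ edges F ∧ θ * (edges F).card ≤ X.card := by
    intro X hX
    obtain ⟨⟨A, B⟩, hAB, rfl⟩ := Finset.mem_image.1 hX
    simp only [hP, Finset.mem_filter, Finset.mem_univ, true_and] at hAB
    refine ⟨Finset.inter_subset_left, ?_⟩
    have h1 := hG.dense A B hAB.1 hAB.2.1 hAB.2.2
    have h2 : (edges G ∩ crossing A B).card ≤ (edges F ∩ crossing A B).card + (edges H).card := by
      refine (Finset.card_le_card fun e he => ?_).trans (Finset.card_union_le _ _)
      rw [Finset.mem_inter] at he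
      rw [Finset.mem_union, Finset.mem_inter, hF, edges_sdiff, Finset.mem_sdiff]
      tauto
    have h3 : ((edges G ∩ crossing A B).card : ℝ) ≤
        (edges F ∩ crossing A B).card + (edges H).card := by exact_mod_cast h2
    have h4 : ((edges H).card : ℝ) ≤ h := by exact_mod_cast (by omega : (edges H).card ≤ h)
    have h5 : θ * (edges F).card ≤ θ * E := mul_le_mul_of_nonneg_left hFE hθ0
    simp only
    linarith
  obtain ⟨R, hRE, hRk, hR⟩ := exists_hitting_set hEne hθ1 h𝓕prop
    (lt_of_le_of_lt (mul_le_mul_of_nonneg_left h𝓕card (pow_nonneg (by linarith) k)) hk)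
  have hRadj : ∀ u v, (SimpleGraph.fromEdgeSet (R : Set (Sym2 V))).Adj u v ↔ s(u, v) ∈ R := by
    intro u v
    rw [SimpleGraph.fromEdgeSet_adj, Finset.mem_coe]
    refine ⟨fun h => h.1, fun h => ⟨h, ?_⟩⟩
    have : F.Adj u v := by simpa using hRE h
    exact this.ne
  have hRF : SimpleGraph.fromEdgeSet (R : Set (Sym2 V)) ≤ F := by
    intro u v huv
    rw [hRadj] at huv
    simpa using hRE huv
  obtain ⟨Γ, hΓF, hΓc, hΓe, hΓn⟩ := exists_sparse_expander hD hs hsn hRF hdegF hfar hsp (by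
    intro A B hAB hA hB
    obtain ⟨e, heR, he⟩ := hR (edges F ∩ crossing A B)
      (Finset.mem_image.2 ⟨(A, B), by simp [hP, hAB, hA, hB], rfl⟩)
    obtain ⟨⟨a, b⟩, hab, rfl⟩ := Finset.mem_image.1 (Finset.mem_inter.1 he).2
    rw [Finset.mem_product] at hab
    exact ⟨a, hab.1, b, hab.2, (hRadj a b).2 heR⟩)
  have hRc : (edges (SimpleGraph.fromEdgeSet (R : Set (Sym2 V)))).card ≤ k := by
    refine (Finset.card_le_card fun e he => ?_).trans hRk
    rw [mem_edges, SimpleGraph.edgeSet_fromEdgeSet] at he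
    simpa using he.1
  refine isHamiltonian_of_boosters (M := M) hV hΓF hΓe hΓn (by omega) ?_
  -- G has more than h boosters of Γ' among its edges, and H has at most h edges, so one booster
  -- survives in F.
  intro Γ' hΓ' hM' hb
  have h1 := hG.boost Γ' (hΓ'.trans hFG) hM' hb
  by_contra! hcon
  have h2 : edges G ∩ boosters Γ' ⊆ edges H := by
    intro e he
    obtain ⟨he1, he2⟩ := Finset.mem_inter.1 he
    have h3 := hcon e he2
    rw [← mem_edges, hF, edges_sdiff, Finset.mem_sdiff] at h3
    by_contra h4
    exact h3 ⟨he1, h4⟩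
  have := Finset.card_le_card h2
  omega

end Robust

/-! ### The upper bound, and reduction to deletions of at most δ - 2 edges -/

section MinDegree

variable {V : Type*} [Fintype V]

theorem card_nbrs_eq_degree (G : SimpleGraph V) (v : V) [Fintype (G.neighborSet v)] :
    (nbrs G v).card = G.degree v := by
  rw [← SimpleGraph.card_neighborFinset_eq_degree]
  congr 1
  ext w
  simp

theorem minDeg_le_card_nbrs (G : SimpleGraph V) (v : V) : minDeg G ≤ (nbrs G v).card := by
  classical
  rw [card_nbrs_eq_degree]
  exact G.minDegree_le_degree v

theorem exists_card_nbrs_eq_minDeg [Nonempty V] (G : SimpleGraph V) :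
    ∃ v, (nbrs G v).card = minDeg G := by
  classical
  obtain ⟨v, hv⟩ := G.exists_minimal_degree_vertex
  exact ⟨v, by rw [card_nbrs_eq_degree]; exact hv.symm⟩

variable [DecidableEq V]

theorem two_le_card_nbrs_of_isHamiltonian {G : SimpleGraph V} (hV : 3 ≤ Fintype.card V)
    (hG : G.IsHamiltonian) (v : V) : 2 ≤ (nbrs G v).card := by
  have : Nontrivial V := Fintype.one_lt_card_iff_nontrivial.1 (by omega)
  obtain ⟨p, hp⟩ := hG.exists_isHamiltonianCycle v
  have hn := hp.isCycle.not_nil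
  have h1 : G.Adj v p.snd := p.adj_snd hn
  have h2 : G.Adj p.penultimate v := p.adj_penultimate hn
  have h3 : p.snd ≠ p.penultimate := hp.isCycle.snd_ne_penultimate
  rw [← Finset.card_pair h3]
  refine Finset.card_le_card fun w hw => ?_
  rw [Finset.mem_insert, Finset.mem_singleton] at hw
  rw [mem_nbrs]
  rcases hw with rfl | rfl
  · exact h1
  · exact h2.symm

/-- Delete all but one edge at a vertex of minimum degree. When that degree is 0, truncated
subtraction means that nothing is deleted, and the graph already fails to be Hamiltonian. -/
theorem globalResilience_le (G : SimpleGraph V) (hV : 3 ≤ Fintype.card V) :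
    globalResilience G SimpleGraph.IsHamiltonian ≤ minDeg G - 1 := by
  have : Nonempty V := Fintype.card_pos_iff.1 (by omega)
  obtain ⟨v, hv⟩ := exists_card_nbrs_eq_minDeg G
  obtain ⟨T, hT, hTc⟩ := Finset.exists_subset_card_eq
    (show minDeg G - 1 ≤ (nbrs G v).card by omega)
  set H := SimpleGraph.fromEdgeSet ((T.image fun w => s(v, w) : Finset (Sym2 V)) : Set (Sym2 V))
    with hH
  have hadj : ∀ w ∈ T, G.Adj v w := fun w hw => mem_nbrs.1 (hT hw)
  have hedges : edges H = T.image fun w => s(v, w) := by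
    ext e
    rw [mem_edges, hH, SimpleGraph.edgeSet_fromEdgeSet, Set.mem_sdiff, Finset.mem_coe]
    refine ⟨fun h => h.1, fun h => ⟨h, ?_⟩⟩
    obtain ⟨w, hw, rfl⟩ := Finset.mem_image.1 h
    simpa using (hadj w hw).ne
  refine Nat.sInf_le ⟨H, ?_, ?_, fun hham => ?_⟩
  · rw [hH, ← SimpleGraph.fromEdgeSet_edgeSet G]
    refine SimpleGraph.fromEdgeSet_mono fun e he => ?_
    rw [Finset.mem_coe] at he
    obtain ⟨w, hw, rfl⟩ := Finset.mem_image.1 he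
    exact hadj w hw
  · rw [ncard_edgeSet, hedges,
      Finset.card_image_of_injective _ fun _ _ hab => Sym2.congr_right.1 hab, hTc]
  · have h1 := two_le_card_nbrs_of_isHamiltonian hV hham v
    have h2 : nbrs (G \ H) v ⊆ nbrs G v \ T := by
      intro w hw
      rw [mem_nbrs, SimpleGraph.sdiff_adj] at hw
      rw [Finset.mem_sdiff, mem_nbrs]
      refine ⟨hw.1, fun hwT => hw.2 ?_⟩
      rw [← SimpleGraph.mem_edgeSet, ← mem_edges, hedges]
      exact Finset.mem_image_of_mem _ hwT
    have h3 := Finset.card_le_card h2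
    rw [Finset.card_sdiff_of_subset hT] at h3
    omega

theorem globalResilience_eq {G : SimpleGraph V} (hV : 3 ≤ Fintype.card V)
    (hG : ∀ H ≤ G, (edges H).card + 2 ≤ minDeg G → (G \ H).IsHamiltonian) :
    (globalResilience G SimpleGraph.IsHamiltonian : ℤ) = max 0 ((minDeg G : ℤ) - 1) := by
  have h1 := globalResilience_le G hV
  have h2 : minDeg G ≤ globalResilience G SimpleGraph.IsHamiltonian + 1 := by
    obtain ⟨H, hHG, hHc, hH⟩ := (isLeast_globalResilience G SimpleGraph.IsHamiltonian
      (SimpleGraph.not_isHamiltonian_bot_of_card_ne_one (by omega))).1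
    by_contra! hcon
    rw [ncard_edgeSet] at hHc
    exact hH (hG H hHG (by omega))
  omega

end MinDegree

/-! ### Expectations over the random edge set, Markov and Chernoff bounds -/

section Probability

open MeasureTheory ProbabilityTheory

variable {V : Type*} [Fintype V] [DecidableEq V]

/-- The probability of an event in the binomial random graph. -/
noncomputable def prob (V : Type*) [Fintype V] (p : unitInterval) (Q : SimpleGraph V → Prop) : ℝ :=
  (SimpleGraph.binomialRandom V p).real {G | Q G}

omit [DecidableEq V] in
theorem prob_mono {p : unitInterval} {Q Q' : SimpleGraph V → Prop} (h : ∀ G, Q G → Q' G) :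
    prob V p Q ≤ prob V p Q' :=
  measureReal_mono fun G hG => h G hG

omit [DecidableEq V] in
theorem prob_or_le (p : unitInterval) (Q Q' : SimpleGraph V → Prop) :
    prob V p (fun G => Q G ∨ Q' G) ≤ prob V p Q + prob V p Q' :=
  measureReal_union_le _ _

omit [DecidableEq V] in
theorem prob_exists_le (p : unitInterval) {ι : Type*} (s : Finset ι)
    (Q : ι → SimpleGraph V → Prop) :
    prob V p (fun G => ∃ i ∈ s, Q i G) ≤ ∑ i ∈ s, prob V p (Q i) := by
  have h : {G : SimpleGraph V | ∃ i ∈ s, Q i G} = ⋃ i ∈ s, {G | Q i G} := by ext; simp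
  unfold prob
  rw [h]
  exact measureReal_biUnion_finset_le _ _

omit [DecidableEq V] in
theorem prob_le_one (p : unitInterval) (Q : SimpleGraph V → Prop) : prob V p Q ≤ 1 :=
  measureReal_le_one

/-- The pairs of distinct vertices. -/
def pairs (V : Type*) [Fintype V] [DecidableEq V] : Finset (Sym2 V) :=
  Finset.univ.filter fun e => ¬ e.IsDiag

theorem edges_subset_pairs (G : SimpleGraph V) : edges G ⊆ pairs V := by
  intro e he
  rw [mem_edges] at he
  simpa [pairs] using G.not_isDiag_of_mem_edgeSet he

theorem card_pairs : (pairs V).card = (Fintype.card V).choose 2 := by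
  rw [← Sym2.card_subtype_not_diag, Fintype.card_subtype, pairs]

/-- The expectation of a function of the edge set of the binomial random graph. -/
noncomputable def expect (V : Type*) [Fintype V] [DecidableEq V] (p : unitInterval)
    (F : Finset (Sym2 V) → ℝ) : ℝ :=
  ∑ S ∈ (pairs V).powerset, (p : ℝ) ^ S.card * (1 - p : ℝ) ^ ((pairs V).card - S.card) * F S

theorem real_binomialRandom_singleton (p : unitInterval) (G : SimpleGraph V) :
    (SimpleGraph.binomialRandom V p).real {G} =
      (p : ℝ) ^ (edges G).card * (1 - p : ℝ) ^ ((pairs V).card - (edges G).card) := by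
  rw [measureReal_def, SimpleGraph.binomialRandom_singleton, ncard_edgeSet, card_pairs,
    Nat.card_eq_fintype_card]
  simp

theorem weight_nonneg (p : unitInterval) (a b : ℕ) : 0 ≤ (p : ℝ) ^ a * (1 - p : ℝ) ^ b :=
  mul_nonneg (pow_nonneg p.2.1 _) (pow_nonneg (by linarith [p.2.2]) _)

/-- Markov's inequality. -/
theorem prob_le_expect (p : unitInterval) {Q : SimpleGraph V → Prop} {F : Finset (Sym2 V) → ℝ}
    (hF0 : ∀ S, 0 ≤ F S) (hF : ∀ G, Q G → 1 ≤ F (edges G)) : prob V p Q ≤ expect V p F := by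
  classical
  have hle : prob V p Q ≤ ∑ G ∈ (Set.toFinite {G | Q G}).toFinset,
      (SimpleGraph.binomialRandom V p).real {G} := by
    refine (prob_mono (Q' := fun G => ∃ G' ∈ (Set.toFinite {G | Q G}).toFinset, G = G') ?_).trans
      (prob_exists_le p _ _)
    exact fun G hG => ⟨G, by simpa using hG, rfl⟩
  refine hle.trans ?_
  unfold expect
  have hinj : Set.InjOn (edges (V := V)) ((Set.toFinite {G | Q G}).toFinset) := by
    intro G _ G' _ h
    rw [← SimpleGraph.edgeSet_inj, ← coe_edges, ← coe_edges, h]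
  calc ∑ G ∈ (Set.toFinite {G | Q G}).toFinset, (SimpleGraph.binomialRandom V p).real {G}
      ≤ ∑ G ∈ (Set.toFinite {G | Q G}).toFinset, (p : ℝ) ^ (edges G).card *
          (1 - p : ℝ) ^ ((pairs V).card - (edges G).card) * F (edges G) := by
        refine Finset.sum_le_sum fun G hG => ?_
        rw [real_binomialRandom_singleton]
        exact le_mul_of_one_le_right (weight_nonneg p _ _) (hF G (by simpa using hG))
    _ = ∑ S ∈ (Set.toFinite {G | Q G}).toFinset.image edges, (p : ℝ) ^ S.card *
          (1 - p : ℝ) ^ ((pairs V).card - S.card) * F S := by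
        rw [Finset.sum_image hinj]
    _ ≤ _ := by
        refine Finset.sum_le_sum_of_subset_of_nonneg (fun S hS => ?_)
          fun S _ _ => mul_nonneg (weight_nonneg p _ _) (hF0 S)
        obtain ⟨G, _, rfl⟩ := Finset.mem_image.1 hS
        exact Finset.mem_powerset.2 (edges_subset_pairs G)

/-- This is independence of the edges: expanding the product over subsets of the pairs reproduces
the expectation. -/
theorem expect_prod (p : unitInterval) (a b : Sym2 V → ℝ) :
    expect V p (fun S => (∏ e ∈ S, a e) * ∏ e ∈ pairs V \ S, b e) =
      ∏ e ∈ pairs V, (p * a e + (1 - p) * b e) := by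
  rw [Finset.prod_add, expect]
  refine Finset.sum_congr rfl fun S hS => ?_
  rw [Finset.prod_mul_distrib, Finset.prod_mul_distrib, Finset.prod_const, Finset.prod_const,
    Finset.card_sdiff_of_subset (Finset.mem_powerset.1 hS)]
  ring

theorem expect_const_mul (p : unitInterval) (c : ℝ) (F : Finset (Sym2 V) → ℝ) :
    expect V p (fun S => c * F S) = c * expect V p F := by
  rw [expect, expect, Finset.mul_sum]
  exact Finset.sum_congr rfl fun S _ => by ring

theorem expect_add (p : unitInterval) (F F' : Finset (Sym2 V) → ℝ) :
    expect V p (fun S => F S + F' S) = expect V p F + expect V p F' := by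
  rw [expect, expect, expect, ← Finset.sum_add_distrib]
  exact Finset.sum_congr rfl fun S _ => by ring

theorem expect_sum (p : unitInterval) {ι : Type*} (s : Finset ι) (F : ι → Finset (Sym2 V) → ℝ) :
    expect V p (fun S => ∑ i ∈ s, F i S) = ∑ i ∈ s, expect V p (F i) := by
  simp only [expect, Finset.mul_sum]
  exact Finset.sum_comm

theorem expect_disjoint (p : unitInterval) {W : Finset (Sym2 V)} (hW : W ⊆ pairs V) :
    expect V p (fun S => if Disjoint S W then 1 else 0) = (1 - p : ℝ) ^ W.card := by
  have h1 := expect_prod (V := V) p (fun e => if e ∈ W then 0 else 1) (fun _ => 1)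
  have h2 : (fun S : Finset (Sym2 V) => (∏ e ∈ S, if e ∈ W then (0 : ℝ) else 1) *
      ∏ e ∈ pairs V \ S, 1) = fun S => if Disjoint S W then 1 else 0 := by
    funext S
    rw [Finset.prod_const_one, mul_one]
    split_ifs with h
    · exact Finset.prod_eq_one fun e he => if_neg (Finset.disjoint_left.1 h he)
    · rw [Finset.not_disjoint_iff] at h
      obtain ⟨e, he, heW⟩ := h
      exact Finset.prod_eq_zero he (if_pos heW)
  rw [h2] at h1
  rw [h1]
  have h3 : ∀ e ∈ pairs V, ((p : ℝ) * (if e ∈ W then 0 else 1) + (1 - p) * 1) =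
      if e ∈ W then (1 - p : ℝ) else 1 := by
    intro e _
    split_ifs <;> ring
  rw [Finset.prod_congr rfl h3, Finset.prod_ite_mem, Finset.inter_eq_right.2 hW,
    Finset.prod_const]

theorem expect_one (p : unitInterval) : expect V p (fun _ => 1) = 1 := by
  have := expect_disjoint p (Finset.empty_subset (pairs V))
  simpa using this

/-- Chernoff's bound, jointly with the presence of prescribed edges. -/
theorem prob_subset_and_le (p : unitInterval) {A W : Finset (Sym2 V)} (hA : A ⊆ pairs V)
    (hW : W ⊆ pairs V) (hAW : Disjoint A W) (t c : ℝ) :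
    prob V p (fun G => A ⊆ edges G ∧ c ≤ t * (edges G ∩ W).card) ≤
      (p : ℝ) ^ A.card * Real.exp ((Real.exp t - 1) * (p * W.card) - c) := by
  -- The weights a give the exponential moment of the number of edges in W, and b annihilates edge
  -- sets missing a pair of A. No sign of t is assumed: negative t gives lower tails.
  set a : Sym2 V → ℝ := fun e => if e ∈ W then Real.exp t else 1 with ha
  set b : Sym2 V → ℝ := fun e => if e ∈ A then 0 else 1 with hb
  have hb0 : ∀ e, 0 ≤ b e := fun e => by rw [hb]; dsimp only; split_ifs <;> norm_num
  have ha0 : ∀ e, 0 ≤ a e := fun e => by rw [ha]; dsimp only; split_ifs <;> positivity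
  have hp0 : (0 : ℝ) ≤ p := p.2.1
  have hp1 : (p : ℝ) ≤ 1 := p.2.2
  refine (prob_le_expect p
    (F := fun S => Real.exp (-c) * ((∏ e ∈ S, a e) * ∏ e ∈ pairs V \ S, b e)) ?_ ?_).trans ?_
  · intro S
    exact mul_nonneg (Real.exp_pos _).le
      (mul_nonneg (Finset.prod_nonneg fun e _ => ha0 e) (Finset.prod_nonneg fun e _ => hb0 e))
  · rintro G ⟨h1, h2⟩
    have h3 : ∏ e ∈ pairs V \ edges G, b e = 1 := by
      refine Finset.prod_eq_one fun e he => if_neg fun heA => ?_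
      exact (Finset.mem_sdiff.1 he).2 (h1 heA)
    have h4 : ∏ e ∈ edges G, a e = Real.exp (t * (edges G ∩ W).card) := by
      rw [ha, Finset.prod_ite_mem, Finset.prod_const, ← Real.exp_nat_mul, mul_comm]
    rw [h3, h4, mul_one, ← Real.exp_add]
    exact Real.one_le_exp (by linarith)
  · rw [expect_const_mul, expect_prod]
    have h5 : ∏ e ∈ pairs V, ((p : ℝ) * a e + (1 - p) * b e) ≤
        ∏ e ∈ pairs V, ((if e ∈ A then (p : ℝ) else 1) *
          (if e ∈ W then Real.exp ((Real.exp t - 1) * p) else 1)) := by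
      refine Finset.prod_le_prod (fun e _ => ?_) fun e _ => ?_
      · exact add_nonneg (mul_nonneg hp0 (ha0 e)) (mul_nonneg (by linarith) (hb0 e))
      · simp only [ha, hb]
        by_cases h6 : e ∈ A
        · have h7 : e ∉ W := Finset.disjoint_left.1 hAW h6
          simp [h6, h7]
        · by_cases h7 : e ∈ W
          · simp only [h6, h7, if_true, if_false, one_mul]
            have := Real.add_one_le_exp ((Real.exp t - 1) * p)
            linarith
          · simp [h6, h7]
    rw [Finset.prod_mul_distrib, Finset.prod_ite_mem, Finset.prod_ite_mem,
      Finset.inter_eq_right.2 hW, Finset.inter_eq_right.2 hA, Finset.prod_const, Finset.prod_const,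
      ← Real.exp_nat_mul] at h5
    refine (mul_le_mul_of_nonneg_left h5 (Real.exp_pos _).le).trans (le_of_eq ?_)
    rw [mul_left_comm, ← Real.exp_add]
    congr 2
    ring

theorem prob_le_exp (p : unitInterval) {W : Finset (Sym2 V)} (hW : W ⊆ pairs V) (t c : ℝ) :
    prob V p (fun G => c ≤ t * (edges G ∩ W).card) ≤
      Real.exp ((Real.exp t - 1) * (p * W.card) - c) := by
  have := prob_subset_and_le p (Finset.empty_subset (pairs V)) hW (Finset.disjoint_empty_left W) t c
  simpa using this

/-- The pairs containing a given vertex. -/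
def star (v : V) : Finset (Sym2 V) := (Finset.univ.erase v).image fun w => s(v, w)

theorem star_subset_pairs (v : V) : star v ⊆ pairs V := by
  intro e he
  obtain ⟨w, hw, rfl⟩ := Finset.mem_image.1 he
  simpa [pairs, eq_comm] using (Finset.mem_erase.1 hw).1

theorem card_star (v : V) : (star v).card = Fintype.card V - 1 := by
  rw [star, Finset.card_image_of_injective _ fun _ _ hab => Sym2.congr_right.1 hab,
    Finset.card_erase_of_mem (Finset.mem_univ _), Finset.card_univ]

theorem star_inter_star {u v : V} (huv : u ≠ v) : star u ∩ star v = {s(u, v)} := by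
  ext e
  simp only [star, Finset.mem_inter, Finset.mem_image, Finset.mem_erase, Finset.mem_univ,
    and_true, Finset.mem_singleton]
  constructor
  · rintro ⟨⟨a, ha, rfl⟩, b, hb, h⟩
    rw [Sym2.eq_iff] at h
    rcases h with ⟨h, _⟩ | ⟨h, _⟩
    · exact absurd h.symm huv
    · rw [h]
  · rintro rfl
    exact ⟨⟨v, huv.symm, rfl⟩, u, huv, Sym2.eq_swap⟩

theorem card_star_union_star {u v : V} (huv : u ≠ v) :
    (star u ∪ star v).card + 3 = 2 * Fintype.card V := by
  have h1 := Finset.card_union_add_card_inter (star u) (star v)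
  rw [star_inter_star huv, Finset.card_singleton, card_star, card_star] at h1
  have h2 : 2 ≤ Fintype.card V := by
    rw [← Finset.card_pair huv, ← Finset.card_univ]
    exact Finset.card_le_card (Finset.subset_univ _)
  omega

theorem card_edges_inter_star (G : SimpleGraph V) (v : V) :
    (edges G ∩ star v).card = (nbrs G v).card := by
  rw [← card_image_nbrs]
  congr 1
  ext e
  simp only [star, Finset.mem_inter, Finset.mem_image, Finset.mem_erase, Finset.mem_univ,
    and_true, mem_edges, mem_nbrs]
  constructor
  · rintro ⟨h1, w, _, rfl⟩
    exact ⟨w, h1, rfl⟩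
  · rintro ⟨w, h1, rfl⟩
    exact ⟨h1, w, (SimpleGraph.Adj.ne h1).symm, rfl⟩

end Probability

/-! ### Low-degree vertices are far apart -/

section ClosePairs

variable {V : Type*}

theorem exists_walk_of_adj_or_eq {G : SimpleGraph V} {u v : V} (h : G.Adj u v ∨ u = v) :
    ∃ w : G.Walk u v, w.length ≤ 1 := by
  rcases h with h | rfl
  · exact ⟨.cons h .nil, by simp⟩
  · exact ⟨.nil, by simp⟩

variable [Fintype V] [DecidableEq V]

omit [Fintype V] in
theorem Close.exists_path {G : SimpleGraph V} {u v : V} (h : Close G u v) (huv : u ≠ v) :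
    ∃ l ∈ Finset.Icc 1 4, ∃ f : Fin (l + 1) → V, Function.Injective f ∧ f 0 = u ∧
      f (Fin.last l) = v ∧ ∀ i : Fin l, G.Adj (f i.castSucc) (f i.succ) := by
  obtain ⟨a, b, c, h1, h2, h3, h4⟩ := h
  obtain ⟨w1, hw1⟩ := exists_walk_of_adj_or_eq h1
  obtain ⟨w2, hw2⟩ := exists_walk_of_adj_or_eq h2
  obtain ⟨w3, hw3⟩ := exists_walk_of_adj_or_eq h3
  obtain ⟨w4, hw4⟩ := exists_walk_of_adj_or_eq h4
  set w := (((w1.append w2).append w3).append w4).bypass with hw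
  have hp : w.IsPath := SimpleGraph.Walk.bypass_isPath _
  have hlen : w.length ≤ 4 := by
    refine (SimpleGraph.Walk.length_bypass_le_length _).trans ?_
    simp only [SimpleGraph.Walk.length_append]
    omega
  have hpos : w.length ≠ 0 := fun h0 => huv (SimpleGraph.Walk.eq_of_length_eq_zero h0)
  refine ⟨w.length, Finset.mem_Icc.2 ⟨by omega, hlen⟩, fun i => w.getVert i, ?_, by simp, by simp,
    fun i => ?_⟩
  · intro i j hij
    exact Fin.ext (hp.getVert_injOn (by simp; omega) (by simp; omega) hij)
  · simpa using w.adj_getVert_succ i.2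

/-- The edges of the path spelled out by `f`. -/
def pathEdges {l : ℕ} (f : Fin (l + 1) → V) : Finset (Sym2 V) :=
  Finset.univ.image fun i : Fin l => s(f i.castSucc, f i.succ)

omit [Fintype V] in
theorem card_pathEdges {l : ℕ} {f : Fin (l + 1) → V} (hf : Function.Injective f) :
    (pathEdges f).card = l := by
  rw [pathEdges, Finset.card_image_of_injective, Finset.card_univ, Fintype.card_fin]
  intro i j hij
  simp only [Sym2.eq_iff, hf.eq_iff, Fin.ext_iff, Fin.val_castSucc, Fin.val_succ] at hij
  exact Fin.ext (by omega)

theorem pathEdges_subset_pairs {l : ℕ} {f : Fin (l + 1) → V} (hf : Function.Injective f) :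
    pathEdges f ⊆ pairs V := by
  intro e he
  obtain ⟨i, _, rfl⟩ := Finset.mem_image.1 he
  simp only [pairs, Finset.mem_filter, Finset.mem_univ, true_and, Sym2.mk_isDiag_iff, hf.eq_iff,
    Fin.ext_iff, Fin.val_castSucc, Fin.val_succ]
  omega

theorem exp_neg_three_le : Real.exp (-3) ≤ 6 / 100 := by
  have h1 : (2.7 : ℝ) ≤ Real.exp 1 := by linarith [Real.exp_one_gt_d9]
  have h2 : (2.7 : ℝ) ^ 3 ≤ Real.exp 1 ^ 3 := pow_le_pow_left₀ (by norm_num) h1 3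
  rw [← Real.exp_nat_mul] at h2
  norm_num at h2
  rw [Real.exp_neg, inv_le_comm₀ (Real.exp_pos _) (by norm_num)]
  linarith

/-- The pairs of the path contribute p^l. The degrees are tested only on the remaining pairs at its
two ends, which are independent of the path, by Chernoff with t = -3. -/
theorem prob_path_le (p : unitInterval) (D : ℕ) {l : ℕ} (hl : 1 ≤ l) (hl4 : l ≤ 4)
    {f : Fin (l + 1) → V} (hf : Function.Injective f) :
    prob V p (fun G => pathEdges f ⊆ edges G ∧ (nbrs G (f 0)).card < 3 * D ∧
      (nbrs G (f (Fin.last l))).card < 3 * D) ≤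
    (p : ℝ) ^ l * Real.exp (18 * D + 7 - 1.88 * (Fintype.card V * p)) := by
  have hne : f 0 ≠ f (Fin.last l) := by
    rw [hf.ne_iff, Ne, Fin.ext_iff]
    simp only [Fin.val_zero, Fin.val_last]
    omega
  set W := (star (f 0) ∪ star (f (Fin.last l))) \ pathEdges f with hW
  have hWp : W ⊆ pairs V := Finset.sdiff_subset.trans
    (Finset.union_subset (star_subset_pairs _) (star_subset_pairs _))
  -- The two stars cover 2|V| - 3 pairs, and the path removes at most four.
  have hcW : 2 * Fintype.card V ≤ W.card + 7 := by
    have h1 := Finset.le_card_sdiff (pathEdges f) (star (f 0) ∪ star (f (Fin.last l)))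
    have h2 := card_star_union_star hne
    rw [card_pathEdges hf, ← hW] at h1
    omega
  refine (prob_mono (Q' := fun G => pathEdges f ⊆ edges G ∧
    (-(18 * D) : ℝ) ≤ -3 * (edges G ∩ W).card) ?_).trans ?_
  · rintro G ⟨h1, h2, h3⟩
    refine ⟨h1, ?_⟩
    have h4 : (edges G ∩ W).card ≤ 6 * D := by
      have h5 : edges G ∩ W ⊆ (edges G ∩ star (f 0)) ∪ (edges G ∩ star (f (Fin.last l))) := by
        rw [← Finset.inter_union_distrib_left]
        exact Finset.inter_subset_inter_left Finset.sdiff_subset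
      have h6 := (Finset.card_le_card h5).trans (Finset.card_union_le _ _)
      rw [card_edges_inter_star, card_edges_inter_star] at h6
      omega
    have h5 : ((edges G ∩ W).card : ℝ) ≤ 6 * D := by exact_mod_cast h4
    linarith
  · refine (prob_subset_and_le p (pathEdges_subset_pairs hf) hWp Finset.disjoint_sdiff
      (-3) (-(18 * D))).trans ?_
    rw [card_pathEdges hf]
    refine mul_le_mul_of_nonneg_left (Real.exp_le_exp.2 ?_) (pow_nonneg p.2.1 _)
    have h1 : (2 * Fintype.card V : ℝ) ≤ W.card + 7 := by exact_mod_cast hcW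
    have hp0 : (0 : ℝ) ≤ p := p.2.1
    have hp1 : (p : ℝ) ≤ 1 := p.2.2
    have h2 : (p : ℝ) * (2 * Fintype.card V - 7) ≤ p * W.card :=
      mul_le_mul_of_nonneg_left (by linarith) hp0
    have h3 : 0 ≤ (p : ℝ) * W.card := mul_nonneg hp0 (Nat.cast_nonneg _)
    have h4 : (Real.exp (-3) - 1) * (p * W.card) ≤ (6 / 100 - 1) * (p * W.card) :=
      mul_le_mul_of_nonneg_right (by linarith [exp_neg_three_le]) h3
    nlinarith

/-- There are at most n^(l+1) paths, and n^(l+1) p^l = n q^l. The two degree conditions gain about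
e^(-1.88q), which beats n ≤ e^(4q/3). -/
theorem prob_close_le (p : unitInterval) {D : ℕ} {q : ℝ} (hq : q = Fintype.card V * p)
    (hq1 : 1 ≤ q) (hn : (Fintype.card V : ℝ) ≤ Real.exp (4 / 3 * q)) (hD : (D : ℝ) ≤ q / 4000 + 2) :
    prob V p (fun G => ∃ u v, u ≠ v ∧ (nbrs G u).card < 3 * D ∧ (nbrs G v).card < 3 * D ∧
      Close G u v) ≤ 4 * (24 * 20 ^ 4) * Real.exp 43 * Real.exp (-(2 / 5 * q)) := by
  classical
  refine (prob_mono (Q' := fun G => ∃ l ∈ Finset.Icc 1 4, ∃ f ∈ Finset.univ.filter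
    (fun f : Fin (l + 1) → V => Function.Injective f), pathEdges f ⊆ edges G ∧
      (nbrs G (f 0)).card < 3 * D ∧ (nbrs G (f (Fin.last l))).card < 3 * D) ?_).trans ?_
  · rintro G ⟨u, v, huv, hu, hv, hc⟩
    obtain ⟨l, hl, f, hf, rfl, rfl, hadj⟩ := hc.exists_path huv
    refine ⟨l, hl, f, by simpa using hf, ?_, hu, hv⟩
    intro e he
    obtain ⟨i, _, rfl⟩ := Finset.mem_image.1 he
    simpa using hadj i
  refine (prob_exists_le p _ _).trans ?_
  have hp0 : (0 : ℝ) ≤ p := p.2.1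
  have hterm : ∀ l ∈ Finset.Icc 1 4, prob V p (fun G => ∃ f ∈ Finset.univ.filter
      (fun f : Fin (l + 1) → V => Function.Injective f), pathEdges f ⊆ edges G ∧
        (nbrs G (f 0)).card < 3 * D ∧ (nbrs G (f (Fin.last l))).card < 3 * D) ≤
      (24 * 20 ^ 4) * Real.exp 43 * Real.exp (-(2 / 5 * q)) := by
    intro l hl
    rw [Finset.mem_Icc] at hl
    refine (prob_exists_le p _ _).trans ?_
    refine (Finset.sum_le_card_nsmul _ _ _ fun f hf =>
      prob_path_le p D hl.1 hl.2 (Finset.mem_filter.1 hf).2).trans ?_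
    rw [nsmul_eq_mul, ← hq]
    have h1 : ((Finset.univ.filter fun f : Fin (l + 1) → V => Function.Injective f).card : ℝ) ≤
        (Fintype.card V : ℝ) ^ (l + 1) := by
      have : (Finset.univ.filter fun f : Fin (l + 1) → V => Function.Injective f).card ≤
          Fintype.card V ^ (l + 1) := by
        refine (Finset.card_filter_le _ _).trans (le_of_eq ?_)
        simp
      exact_mod_cast this
    have hql : q ^ l ≤ 24 * 20 ^ 4 * Real.exp (q / 20) := by
      refine (pow_le_pow_right₀ hq1 hl.2).trans ?_
      have := Real.pow_div_factorial_le_exp (q / 20) (by linarith) 4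
      norm_num [Nat.factorial] at this
      linarith
    calc _ ≤ (Fintype.card V : ℝ) ^ (l + 1) * ((p : ℝ) ^ l * Real.exp (18 * D + 7 - 1.88 * q)) :=
          mul_le_mul_of_nonneg_right h1 (mul_nonneg (pow_nonneg hp0 _) (Real.exp_pos _).le)
      _ = (Fintype.card V : ℝ) * q ^ l * Real.exp (18 * D + 7 - 1.88 * q) := by
          rw [hq]; ring
      _ ≤ Real.exp (4 / 3 * q) * (24 * 20 ^ 4 * Real.exp (q / 20)) *
            Real.exp (18 * D + 7 - 1.88 * q) := by
          refine mul_le_mul_of_nonneg_right ?_ (Real.exp_pos _).le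
          exact mul_le_mul hn hql (by positivity) (Real.exp_pos _).le
      _ = 24 * 20 ^ 4 * Real.exp (4 / 3 * q + q / 20 + (18 * D + 7 - 1.88 * q)) := by
          rw [Real.exp_add, Real.exp_add]; ring
      -- The constant is 7 + 18·2. The coefficient of q is 4/3 + 1/20 + 18/4000 - 1.88 < -2/5.
      _ ≤ 24 * 20 ^ 4 * Real.exp (43 + -(2 / 5 * q)) := by
          refine mul_le_mul_of_nonneg_left (Real.exp_le_exp.2 ?_) (by norm_num)
          linarith
      _ = _ := by rw [Real.exp_add]; ring
  refine (Finset.sum_le_sum hterm).trans (le_of_eq ?_)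
  simp
  ring

end ClosePairs

/-! ### Small sets span few edges -/

section Sparse

variable {V : Type*} [Fintype V] [DecidableEq V]

/-- Each U fails with probability at most x^|U|, where x = e^(-3q). Summing over nonempty U gives (1
+ x)^n - 1 ≤ 2nx, and n ≤ e^(4q/3) makes nx at most e^(-q). -/
theorem prob_not_sparse_le (p : unitInterval) {D s : ℕ} {q : ℝ} (hq : q = Fintype.card V * p)
    (hn : (Fintype.card V : ℝ) ≤ Real.exp (4 / 3 * q)) (hq0 : 0 ≤ q) (hD : q ≤ 4000 * D)
    (hs : 7 * s * Real.exp 224000 ≤ Fintype.card V) :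
    prob V p (fun G => ∃ U : Finset V, U.Nonempty ∧ U.card ≤ 7 * s ∧
      D * U.card ≤ 14 * (edges G ∩ U.sym2).card) ≤ 2 * Real.exp (-q) := by
  classical
  have hp0 : (0 : ℝ) ≤ p := p.2.1
  set x := Real.exp (-(3 * q)) with hx
  have hU : ∀ U : Finset V, U.card ≤ 7 * s →
      prob V p (fun G => D * U.card ≤ 14 * (edges G ∩ U.sym2).card) ≤ x ^ U.card := by
    intro U hUs
    set W := U.sym2 ∩ pairs V with hW
    have hWc : (W.card : ℝ) ≤ (U.card : ℝ) ^ 2 := by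
      have h1 : W.card ≤ U.card ^ 2 := by
        refine (Finset.card_le_card Finset.inter_subset_left).trans ?_
        rw [Finset.card_sym2, Nat.choose_two_right]
        refine Nat.div_le_of_le_mul ?_
        simp only [Nat.add_sub_cancel]
        nlinarith [Nat.le_self_pow (two_ne_zero) U.card]
      exact_mod_cast h1
    -- Chernoff with t = 224000 = 14·16000. The threshold 16000 D|U| is at least 4q|U|, while the
    -- size bound on U keeps the moment term below q|U|.
    refine (prob_mono (Q' := fun G => (16000 * (D * U.card) : ℝ) ≤
      224000 * (edges G ∩ W).card) ?_).trans ?_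
    · intro G hG
      have h1 : edges G ∩ W = edges G ∩ U.sym2 := by
        rw [hW, ← Finset.inter_assoc, Finset.inter_eq_left]
        exact Finset.inter_subset_left.trans (edges_subset_pairs G)
      rw [h1]
      have h2 : (D * U.card : ℝ) ≤ 14 * (edges G ∩ U.sym2).card := by exact_mod_cast hG
      linarith
    · refine (prob_le_exp p Finset.inter_subset_right 224000 _).trans ?_
      rw [hx, ← Real.exp_nat_mul]
      refine Real.exp_le_exp.2 ?_
      have hE : 0 < Real.exp 224000 := Real.exp_pos _
      have hu0 : (0 : ℝ) ≤ U.card := Nat.cast_nonneg _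
      have hus : (U.card : ℝ) ≤ 7 * s := by exact_mod_cast hUs
      have h1 : (Real.exp 224000 - 1) * (p * W.card) ≤
          Real.exp 224000 * (p * (U.card : ℝ) ^ 2) := by
        have h2 : (p : ℝ) * W.card ≤ p * (U.card : ℝ) ^ 2 := mul_le_mul_of_nonneg_left hWc hp0
        have h3 : 0 ≤ (p : ℝ) * W.card := mul_nonneg hp0 (Nat.cast_nonneg _)
        calc _ ≤ Real.exp 224000 * (p * W.card) := by
              apply mul_le_mul_of_nonneg_right _ h3; linarith
          _ ≤ _ := mul_le_mul_of_nonneg_left h2 hE.le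
      have h2 : Real.exp 224000 * (p * (U.card : ℝ) ^ 2) ≤ U.card * q := by
        have h3 : (U.card : ℝ) * Real.exp 224000 ≤ Fintype.card V :=
          (mul_le_mul_of_nonneg_right hus hE.le).trans hs
        have h4 : (p * U.card : ℝ) * (U.card * Real.exp 224000) ≤ (p * U.card) * Fintype.card V :=
          mul_le_mul_of_nonneg_left h3 (mul_nonneg hp0 hu0)
        rw [hq]
        calc _ = (p * U.card : ℝ) * (U.card * Real.exp 224000) := by ring
          _ ≤ _ := h4
          _ = _ := by ring
      have h3 : (U.card : ℝ) * q ≤ U.card * (4000 * D) := mul_le_mul_of_nonneg_left hD hu0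
      have h4 : (16000 * (D * U.card) : ℝ) = 4 * (U.card * (4000 * D)) := by ring
      rw [h4]
      have h5 : (U.card : ℝ) * -(3 * q) = -(3 * (U.card * q)) := by ring
      rw [h5]
      linarith
  refine (prob_mono (Q' := fun G => ∃ U ∈ Finset.univ.filter
    (fun U : Finset V => U.Nonempty ∧ U.card ≤ 7 * s),
      D * U.card ≤ 14 * (edges G ∩ U.sym2).card) ?_).trans ?_
  · rintro G ⟨U, h1, h2, h3⟩
    exact ⟨U, by simp [h1, h2], h3⟩
  refine (prob_exists_le p _ _).trans ?_
  have hx0 : 0 < x := Real.exp_pos _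
  have hnx : (Fintype.card V : ℝ) * x ≤ Real.exp (-q) := by
    calc (Fintype.card V : ℝ) * x ≤ Real.exp (4 / 3 * q) * x :=
          mul_le_mul_of_nonneg_right hn hx0.le
      _ = Real.exp (4 / 3 * q + -(3 * q)) := by rw [Real.exp_add]
      _ ≤ _ := Real.exp_le_exp.2 (by linarith)
  have hnx1 : (Fintype.card V : ℝ) * x ≤ 1 := hnx.trans (Real.exp_le_one_iff.2 (by linarith))
  have hnx0 : 0 ≤ (Fintype.card V : ℝ) * x := by positivity
  calc _ ≤ ∑ U ∈ Finset.univ.filter (fun U : Finset V => U.Nonempty ∧ U.card ≤ 7 * s),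
        x ^ U.card := Finset.sum_le_sum fun U hU' => hU U (Finset.mem_filter.1 hU').2.2
    _ ≤ ∑ U ∈ (Finset.univ : Finset (Finset V)).erase ∅, x ^ U.card := by
        refine Finset.sum_le_sum_of_subset_of_nonneg (fun U hU' => ?_) fun U _ _ => by positivity
        exact Finset.mem_erase.2 ⟨(Finset.mem_filter.1 hU').2.1.ne_empty, Finset.mem_univ _⟩
    _ = (x + 1) ^ Fintype.card V - 1 := by
        rw [Finset.sum_erase_eq_sub (Finset.mem_univ _)]
        have := Finset.sum_pow_mul_eq_add_pow x 1 (Finset.univ : Finset V)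
        simp only [one_pow, mul_one, Finset.powerset_univ, Finset.card_univ] at this
        rw [this]; simp
    _ ≤ Real.exp (Fintype.card V * x) - 1 := by
        rw [Real.exp_nat_mul]
        exact sub_le_sub_right (pow_le_pow_left₀ (by positivity) (Real.add_one_le_exp x) _) _
    _ ≤ 2 * (Fintype.card V * x) := by
        have := Real.abs_exp_sub_one_le (x := Fintype.card V * x) (by rw [abs_of_nonneg hnx0]; exact hnx1)
        rw [abs_of_nonneg hnx0] at this
        exact (le_abs_self _).trans this
    _ ≤ _ := by linarith

end Sparse

/-! ### Edges between large sets, total edges, and boosters -/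

section EdgeCounts

variable {V : Type*} [Fintype V] [DecidableEq V]

theorem exp_neg_one_le : Real.exp (-1) ≤ 4 / 10 := by
  rw [Real.exp_neg, inv_le_comm₀ (Real.exp_pos _) (by norm_num)]
  linarith [Real.exp_one_gt_d9]

theorem exp_neg_five_le : Real.exp (-5) ≤ 7 / 1000 := by
  have h1 : (2.71 : ℝ) ≤ Real.exp 1 := by linarith [Real.exp_one_gt_d9]
  have h2 : (2.71 : ℝ) ^ 5 ≤ Real.exp 1 ^ 5 := pow_le_pow_left₀ (by norm_num) h1 5
  rw [← Real.exp_nat_mul] at h2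
  norm_num at h2
  rw [Real.exp_neg, inv_le_comm₀ (Real.exp_pos _) (by norm_num)]
  linarith

theorem four_lt_exp_two : (4 : ℝ) < Real.exp 2 := by
  have h1 : (2.7 : ℝ) ≤ Real.exp 1 := by linarith [Real.exp_one_gt_d9]
  have h2 : (2.7 : ℝ) ^ 2 ≤ Real.exp 1 ^ 2 := pow_le_pow_left₀ (by norm_num) h1 2
  rw [← Real.exp_nat_mul] at h2
  norm_num at h2
  linarith

theorem crossing_subset_pairs {A B : Finset V} (h : Disjoint A B) : crossing A B ⊆ pairs V := by
  intro e he
  obtain ⟨⟨a, b⟩, hab, rfl⟩ := Finset.mem_image.1 he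
  rw [Finset.mem_product] at hab
  simp only [pairs, Finset.mem_filter, Finset.mem_univ, true_and, Sym2.mk_isDiag_iff]
  rintro rfl
  exact Finset.disjoint_left.1 h hab.1 hab.2

omit [Fintype V] in
theorem card_crossing {A B : Finset V} (h : Disjoint A B) :
    (crossing A B).card = A.card * B.card := by
  rw [crossing, Finset.card_image_of_injOn, Finset.card_product]
  rintro ⟨a, b⟩ hab ⟨c, d⟩ hcd heq
  rw [Finset.mem_coe, Finset.mem_product] at hab hcd
  simp only [Sym2.eq_iff] at heq
  rcases heq with ⟨h1, h2⟩ | ⟨h1, _⟩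
  · rw [h1, h2]
  · dsimp only at h1 hab hcd
    subst h1
    exact absurd hcd.2 (Finset.disjoint_left.1 h hab.1)

/-- At most 4^n < e^(2n) pairs (A, B) occur. Each has mean at least η²qn ≥ 10n, and falling below a
quarter of η²qn has probability at most e^(-3n). -/
theorem prob_not_dense_le (p : unitInterval) {s : ℕ} {q η : ℝ} (hq : q = Fintype.card V * p)
    (hη : 0 ≤ η) (hs : η * Fintype.card V ≤ s) (hηq : 10 ≤ η ^ 2 * q) :
    prob V p (fun G => ∃ A B : Finset V, Disjoint A B ∧ s ≤ A.card ∧ s ≤ B.card ∧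
      ((edges G ∩ crossing A B).card : ℝ) < q * Fintype.card V * η ^ 2 / 4) ≤
      Real.exp (-Fintype.card V) := by
  classical
  have hp0 : (0 : ℝ) ≤ p := p.2.1
  set n : ℝ := (Fintype.card V : ℝ) with hn
  have hn0 : 0 ≤ n := Nat.cast_nonneg _
  refine (prob_mono (Q' := fun G => ∃ r ∈ Finset.univ.filter (fun r : Finset V × Finset V =>
    Disjoint r.1 r.2 ∧ s ≤ r.1.card ∧ s ≤ r.2.card),
      -(q * n * η ^ 2 / 4) ≤ -1 * ((edges G ∩ crossing r.1 r.2).card : ℝ)) ?_).trans ?_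
  · rintro G ⟨A, B, h1, h2, h3, h4⟩
    exact ⟨(A, B), by simp [h1, h2, h3], by dsimp only; linarith⟩
  refine (prob_exists_le p _ _).trans ?_
  have hterm : ∀ r ∈ Finset.univ.filter (fun r : Finset V × Finset V =>
      Disjoint r.1 r.2 ∧ s ≤ r.1.card ∧ s ≤ r.2.card),
      prob V p (fun G => -(q * n * η ^ 2 / 4) ≤ -1 * ((edges G ∩ crossing r.1 r.2).card : ℝ)) ≤
        Real.exp (-(3 * n)) := by
    rintro ⟨A, B⟩ hr
    simp only [Finset.mem_filter, Finset.mem_univ, true_and] at hr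
    obtain ⟨h1, h2, h3⟩ := hr
    refine (prob_le_exp p (crossing_subset_pairs h1) (-1) _).trans (Real.exp_le_exp.2 ?_)
    rw [card_crossing h1, Nat.cast_mul]
    have hA : η * n ≤ A.card := hs.trans (by exact_mod_cast h2)
    have hB : η * n ≤ B.card := hs.trans (by exact_mod_cast h3)
    have hηn : 0 ≤ η * n := mul_nonneg hη hn0
    have hAB : (η * n) * (η * n) ≤ (A.card : ℝ) * B.card :=
      mul_le_mul hA hB hηn (Nat.cast_nonneg _)
    have h4 : (p : ℝ) * ((η * n) * (η * n)) ≤ p * (A.card * B.card) :=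
      mul_le_mul_of_nonneg_left hAB hp0
    have h5 : 0 ≤ (p : ℝ) * ((η * n) * (η * n)) := mul_nonneg hp0 (mul_nonneg hηn hηn)
    have h6 : (p : ℝ) * ((η * n) * (η * n)) = η ^ 2 * q * n := by rw [hq]; ring
    rw [h6] at h4 h5
    have h7 : (Real.exp (-1) - 1) * (p * (A.card * B.card)) ≤
        (4 / 10 - 1) * (p * (A.card * B.card)) :=
      mul_le_mul_of_nonneg_right (by linarith [exp_neg_one_le]) (h5.trans h4)
    have h8 : 10 * n ≤ η ^ 2 * q * n := mul_le_mul_of_nonneg_right hηq hn0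
    have h9 : q * n * η ^ 2 / 4 = (η ^ 2 * q * n) / 4 := by ring
    rw [h9]
    linarith
  refine (Finset.sum_le_card_nsmul _ _ _ hterm).trans ?_
  rw [nsmul_eq_mul]
  have hcard : ((Finset.univ.filter (fun r : Finset V × Finset V =>
      Disjoint r.1 r.2 ∧ s ≤ r.1.card ∧ s ≤ r.2.card)).card : ℝ) ≤ Real.exp (2 * n) := by
    have h1 : (Finset.univ.filter (fun r : Finset V × Finset V =>
        Disjoint r.1 r.2 ∧ s ≤ r.1.card ∧ s ≤ r.2.card)).card ≤ 4 ^ Fintype.card V := by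
      refine (Finset.card_filter_le _ _).trans (le_of_eq ?_)
      rw [Finset.card_univ, Fintype.card_prod, Fintype.card_finset, ← mul_pow]
      norm_num
    calc _ ≤ (4 : ℝ) ^ Fintype.card V := by exact_mod_cast h1
      _ ≤ Real.exp 2 ^ Fintype.card V := pow_le_pow_left₀ (by norm_num) four_lt_exp_two.le _
      _ = _ := by rw [← Real.exp_nat_mul, mul_comm]
  refine (mul_le_mul_of_nonneg_right hcard (Real.exp_pos _).le).trans (le_of_eq ?_)
  rw [← Real.exp_add]
  congr 1
  ring

theorem card_pairs_le : ((pairs V).card : ℝ) ≤ (Fintype.card V : ℝ) ^ 2 / 2 := by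
  rw [card_pairs]
  have := Nat.choose_le_pow_div (α := ℝ) 2 (Fintype.card V)
  simpa using this

theorem prob_size_le (p : unitInterval) {q : ℝ} (hq : q = Fintype.card V * p) (hq10 : 10 ≤ q) :
    prob V p (fun G => q * Fintype.card V < (edges G).card) ≤ Real.exp (-Fintype.card V) := by
  have hp0 : (0 : ℝ) ≤ p := p.2.1
  set n : ℝ := (Fintype.card V : ℝ) with hn
  have hn0 : 0 ≤ n := Nat.cast_nonneg _
  refine (prob_mono (Q' := fun G => q * n ≤ 1 * ((edges G ∩ pairs V).card : ℝ)) ?_).trans ?_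
  · intro G hG
    rw [Finset.inter_eq_left.2 (edges_subset_pairs G), one_mul]
    exact le_of_lt hG
  · refine (prob_le_exp p le_rfl 1 _).trans (Real.exp_le_exp.2 ?_)
    have h1 : (p : ℝ) * (pairs V).card ≤ q * n / 2 := by
      refine (mul_le_mul_of_nonneg_left card_pairs_le hp0).trans (le_of_eq ?_)
      rw [hq]; ring
    have h2 : (Real.exp 1 - 1) * (p * (pairs V).card) ≤ (1.72 : ℝ) * (p * (pairs V).card) :=
      mul_le_mul_of_nonneg_right (by linarith [Real.exp_one_lt_d9])
        (mul_nonneg hp0 (Nat.cast_nonneg _))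
    have h3 : 10 * n ≤ q * n := mul_le_mul_of_nonneg_right hq10 hn0
    linarith

theorem boosters_subset_pairs (Γ : SimpleGraph V) : boosters Γ ⊆ pairs V := by
  intro e he
  simp only [boosters, Finset.mem_filter, Finset.mem_univ, true_and] at he
  simpa [pairs] using he.1

theorem disjoint_edges_boosters (Γ : SimpleGraph V) : Disjoint (edges Γ) (boosters Γ) := by
  rw [Finset.disjoint_right]
  intro e he
  simp only [boosters, Finset.mem_filter, Finset.mem_univ, true_and] at he
  rw [mem_edges]
  exact he.2.1

theorem edges_fromEdgeSet_of_subset {S : Finset (Sym2 V)} (hS : S ⊆ pairs V) :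
    edges (SimpleGraph.fromEdgeSet (S : Set (Sym2 V))) = S := by
  ext e
  rw [mem_edges, SimpleGraph.edgeSet_fromEdgeSet, Set.mem_sdiff, Finset.mem_coe]
  refine ⟨fun h => h.1, fun h => ⟨h, ?_⟩⟩
  simpa [pairs] using hS h

/-- Weight each S by e^(5(M - |S|)) ≥ 1, drop the size restriction and apply the binomial theorem.
The factor e^(-5) makes the quadratic term small enough for `prob_not_boost_le`. -/
theorem sum_pow_card_le (p : unitInterval) (M : ℕ) :
    ∑ S ∈ (pairs V).powerset.filter (fun S => S.card ≤ M), (p : ℝ) ^ S.card ≤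
      Real.exp (5 * M + 7 / 1000 * (p * (pairs V).card)) := by
  have hp0 : (0 : ℝ) ≤ p := p.2.1
  have hterm : ∀ S ∈ (pairs V).powerset.filter (fun S => S.card ≤ M), (p : ℝ) ^ S.card ≤
      Real.exp (5 * M) * (Real.exp (-5) * p) ^ S.card := by
    intro S hS
    have hSM : (S.card : ℝ) ≤ M := by exact_mod_cast (Finset.mem_filter.1 hS).2
    rw [mul_pow, ← mul_assoc, ← Real.exp_nat_mul, ← Real.exp_add]
    exact le_mul_of_one_le_left (pow_nonneg hp0 _) (Real.one_le_exp (by linarith))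
  have h0 : 0 ≤ Real.exp (-5) * p := mul_nonneg (Real.exp_pos _).le hp0
  calc _ ≤ ∑ S ∈ (pairs V).powerset.filter (fun S => S.card ≤ M),
        Real.exp (5 * M) * (Real.exp (-5) * p) ^ S.card := Finset.sum_le_sum hterm
    _ ≤ ∑ S ∈ (pairs V).powerset, Real.exp (5 * M) * (Real.exp (-5) * p) ^ S.card :=
        Finset.sum_le_sum_of_subset_of_nonneg (Finset.filter_subset _ _) fun S _ _ =>
          mul_nonneg (Real.exp_pos _).le (pow_nonneg h0 _)
    _ = Real.exp (5 * M) * (Real.exp (-5) * p + 1) ^ (pairs V).card := by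
        rw [← Finset.mul_sum]
        have := Finset.sum_pow_mul_eq_add_pow (Real.exp (-5) * p) 1 (pairs V)
        simp only [one_pow, mul_one] at this
        rw [this]
    _ ≤ Real.exp (5 * M) * Real.exp ((pairs V).card * (Real.exp (-5) * p)) := by
        rw [Real.exp_nat_mul]
        exact mul_le_mul_of_nonneg_left
          (pow_le_pow_left₀ (by linarith) (Real.add_one_le_exp _) _) (Real.exp_pos _).le
    _ ≤ _ := by
        rw [← Real.exp_add]
        refine Real.exp_le_exp.2 ?_
        have h1 : Real.exp (-5) * (p * (pairs V).card) ≤ 7 / 1000 * (p * (pairs V).card) :=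
          mul_le_mul_of_nonneg_right exp_neg_five_le (mul_nonneg hp0 (Nat.cast_nonneg _))
        have h2 : ((pairs V).card : ℝ) * (Real.exp (-5) * p) =
          Real.exp (-5) * (p * (pairs V).card) := by ring
        linarith

/-- Union bound over sparse Γ: its edges are disjoint from its boosters, so the event costs p^e(Γ)
times a Chernoff factor exponentially small in qn, and `sum_pow_card_le` controls the sum. -/
theorem prob_not_boost_le (p : unitInterval) {M h : ℕ} {q : ℝ} (hq : q = Fintype.card V * p)
    (hq200 : 200 ≤ q) (hV : 10000 ≤ Fintype.card V) (hh : (h : ℝ) ≤ 2 * q + 1)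
    (hM : (M : ℝ) ≤ q * Fintype.card V / 1000) :
    prob V p (fun G => ∃ Γ ≤ G, (edges Γ).card ≤ M ∧
      (Fintype.card V / 4 + 1) ^ 2 ≤ 2 * (boosters Γ).card ∧
      (edges G ∩ boosters Γ).card ≤ h) ≤ Real.exp (-Fintype.card V) := by
  classical
  have hp0 : (0 : ℝ) ≤ p := p.2.1
  set n : ℝ := (Fintype.card V : ℝ) with hn
  have hn0 : 0 ≤ n := Nat.cast_nonneg _
  have hn1 : 10000 ≤ n := by rw [hn]; exact_mod_cast hV
  let g : Finset (Sym2 V) → SimpleGraph V := fun S => SimpleGraph.fromEdgeSet (S : Set (Sym2 V))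
  let T := ((pairs V).powerset.filter fun S => S.card ≤ M).filter
    fun S => (Fintype.card V / 4 + 1) ^ 2 ≤ 2 * (boosters (g S)).card
  refine (prob_mono (Q' := fun G => ∃ S ∈ T, S ⊆ edges G ∧
    (-h : ℝ) ≤ -1 * (edges G ∩ boosters (g S)).card) ?_).trans ?_
  · rintro G ⟨Γ, h1, h2, h3, h4⟩
    have hg : g (edges Γ) = Γ := by
      simp only [g, coe_edges, SimpleGraph.fromEdgeSet_edgeSet]
    refine ⟨edges Γ, ?_, edges_mono h1, ?_⟩
    · simp only [T, Finset.mem_filter, Finset.mem_powerset, hg]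
      exact ⟨⟨edges_subset_pairs Γ, h2⟩, h3⟩
    · rw [hg]
      have : ((edges G ∩ boosters Γ).card : ℝ) ≤ h := by exact_mod_cast h4
      linarith
  refine (prob_exists_le p _ _).trans ?_
  have hterm : ∀ S ∈ T, prob V p (fun G => S ⊆ edges G ∧
      (-h : ℝ) ≤ -1 * (edges G ∩ boosters (g S)).card) ≤
      (p : ℝ) ^ S.card * Real.exp (h - 6 / 320 * (q * n)) := by
    intro S hS
    simp only [T, Finset.mem_filter, Finset.mem_powerset] at hS
    obtain ⟨⟨hSp, _⟩, hb⟩ := hS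
    have hd : Disjoint S (boosters (g S)) := by
      have := disjoint_edges_boosters (g S)
      rwa [edges_fromEdgeSet_of_subset hSp] at this
    refine (prob_subset_and_le p hSp (boosters_subset_pairs _) hd (-1) (-h)).trans ?_
    refine mul_le_mul_of_nonneg_left (Real.exp_le_exp.2 ?_) (pow_nonneg hp0 _)
    -- At least n²/32 boosters have mean at least qn/32; Chernoff with t = -1 keeps 6/10 of it, that
    -- is 6/320.
    have h1 : n ^ 2 ≤ 32 * (boosters (g S)).card := by
      have h2 : Fintype.card V ≤ 4 * (Fintype.card V / 4 + 1) := by omega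
      have h3 : Fintype.card V ^ 2 ≤ 32 * (boosters (g S)).card := by
        calc Fintype.card V ^ 2 ≤ (4 * (Fintype.card V / 4 + 1)) ^ 2 := Nat.pow_le_pow_left h2 2
          _ = 16 * (Fintype.card V / 4 + 1) ^ 2 := by ring
          _ ≤ 16 * (2 * (boosters (g S)).card) := Nat.mul_le_mul_left _ hb
          _ = _ := by ring
      rw [hn]
      exact_mod_cast h3
    have h2 : (p : ℝ) * n ^ 2 ≤ p * (32 * (boosters (g S)).card) :=
      mul_le_mul_of_nonneg_left h1 hp0
    have h3 : (p : ℝ) * n ^ 2 = q * n := by rw [hq]; ring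
    have h4 : (Real.exp (-1) - 1) * (p * (boosters (g S)).card) ≤
        (4 / 10 - 1) * (p * (boosters (g S)).card) :=
      mul_le_mul_of_nonneg_right (by linarith [exp_neg_one_le])
        (mul_nonneg hp0 (Nat.cast_nonneg _))
    rw [h3] at h2
    linarith
  calc _ ≤ ∑ S ∈ T, (p : ℝ) ^ S.card * Real.exp (h - 6 / 320 * (q * n)) := Finset.sum_le_sum hterm
    _ ≤ ∑ S ∈ (pairs V).powerset.filter (fun S => S.card ≤ M),
          (p : ℝ) ^ S.card * Real.exp (h - 6 / 320 * (q * n)) :=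
        Finset.sum_le_sum_of_subset_of_nonneg (Finset.filter_subset _ _) fun S _ _ =>
          mul_nonneg (pow_nonneg hp0 _) (Real.exp_pos _).le
    _ ≤ Real.exp (5 * M + 7 / 1000 * (p * (pairs V).card)) *
          Real.exp (h - 6 / 320 * (q * n)) := by
        rw [← Finset.sum_mul]
        exact mul_le_mul_of_nonneg_right (sum_pow_card_le p M) (Real.exp_pos _).le
    _ ≤ _ := by
        rw [← Real.exp_add]
        refine Real.exp_le_exp.2 ?_
        -- The terms 5M ≤ qn/200 and 7qn/2000 stay below 6qn/320, with enough left for h + n.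
        have h1 : (p : ℝ) * (pairs V).card ≤ q * n / 2 := by
          refine (mul_le_mul_of_nonneg_left card_pairs_le hp0).trans (le_of_eq ?_)
          rw [hq]; ring
        have h2 : 200 * n ≤ q * n := mul_le_mul_of_nonneg_right hq200 hn0
        have h3 : q * 10000 ≤ q * n := mul_le_mul_of_nonneg_left hn1 (by linarith)
        linarith

end EdgeCounts

/-! ### Isolated vertices in the sparse regime -/

section Isolated

variable {V : Type*} [Fintype V] [DecidableEq V]

/-- The second moment method for isolated vertices. -/
theorem prob_no_isolated_le (p : unitInterval) (hp : (p : ℝ) < 1) {μ : ℝ}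
    (hμ : μ = Fintype.card V * (1 - p : ℝ) ^ (Fintype.card V - 1)) (hV : 2 ≤ Fintype.card V) :
    prob V p (fun G => ∀ v, (nbrs G v).card ≠ 0) ≤ 1 / μ + p / (1 - p) := by
  set r : ℝ := 1 - p with hr
  have hr0 : 0 < r := by rw [hr]; linarith
  set n := Fintype.card V with hn
  have hn0 : (0 : ℝ) < n := by exact_mod_cast (by omega : 0 < n)
  have hμ0 : 0 < μ := by rw [hμ]; positivity
  let I : V → Finset (Sym2 V) → ℝ := fun v S => if Disjoint S (star v) then 1 else 0
  have hIE : ∀ v, expect V p (I v) = r ^ (n - 1) := by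
    intro v
    rw [expect_disjoint p (star_subset_pairs v), card_star]
  -- Distinct stars share exactly one pair, so off the diagonal the exponent is 2n - 3. This single
  -- pair is the source of the error p / (1 - p).
  have hIIE : ∀ u v, expect V p (fun S => I u S * I v S) ≤
      (if u = v then r ^ (n - 1) else 0) + r ^ (2 * n - 3) := by
    intro u v
    have h1 : (fun S => I u S * I v S) = fun S => if Disjoint S (star u ∪ star v) then 1 else 0 := by
      funext S
      simp only [I, Finset.disjoint_union_right]
      by_cases h1 : Disjoint S (star u) <;> by_cases h2 : Disjoint S (star v) <;> simp [h1, h2]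
    rw [h1, expect_disjoint p (Finset.union_subset (star_subset_pairs u) (star_subset_pairs v))]
    by_cases huv : u = v
    · subst huv
      rw [Finset.union_self, card_star, if_pos rfl]
      have : 0 ≤ r ^ (2 * n - 3) := by positivity
      linarith
    · have h2 := card_star_union_star huv
      rw [if_neg huv, zero_add, show (star u ∪ star v).card = 2 * n - 3 by omega]
  have hsum : ∑ u : V, ∑ v : V, expect V p (fun S => I u S * I v S) ≤ μ + μ ^ 2 / r := by
    calc _ ≤ ∑ u : V, ∑ v : V, ((if u = v then r ^ (n - 1) else 0) + r ^ (2 * n - 3)) :=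
          Finset.sum_le_sum fun u _ => Finset.sum_le_sum fun v _ => hIIE u v
      _ = n * r ^ (n - 1) + n ^ 2 * r ^ (2 * n - 3) := by
          simp only [Finset.sum_add_distrib, Finset.sum_ite_eq, Finset.mem_univ, if_true,
            Finset.sum_const, Finset.card_univ, nsmul_eq_mul]
          ring
      _ = μ + μ ^ 2 / r := by
          have h1 : (r ^ (n - 1)) ^ 2 = r ^ (2 * n - 3) * r := by
            rw [← pow_mul, ← pow_succ]
            congr 1
            omega
          rw [hμ, mul_pow, h1]
          field_simp
  -- Chebyshev for the number X of isolated vertices: (X/μ - 1)² equals 1 when X = 0.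
  refine (prob_le_expect p (F := fun S => (1 / μ * ∑ v, I v S - 1) ^ 2) (fun S => sq_nonneg _)
    ?_).trans ?_
  · intro G hG
    have h1 : ∑ v, I v (edges G) = 0 := by
      refine Finset.sum_eq_zero fun v _ => if_neg fun hd => hG v ?_
      rw [← card_edges_inter_star, Finset.disjoint_iff_inter_eq_empty.1 hd, Finset.card_empty]
    rw [h1]; norm_num
  · have hexp : (fun S => (1 / μ * ∑ v, I v S - 1) ^ 2) =
        fun S => (1 / μ ^ 2 * ∑ u, ∑ v, I u S * I v S) + ((-2 / μ) * ∑ v, I v S + 1) := by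
      funext S
      rw [← Finset.sum_mul_sum]
      field_simp
      ring
    rw [hexp, expect_add, expect_add, expect_const_mul, expect_const_mul, expect_one, expect_sum,
      expect_sum]
    simp only [hIE, expect_sum]
    rw [Finset.sum_const, Finset.card_univ, nsmul_eq_mul, ← hn, ← hμ]
    have h1 : 1 / μ ^ 2 * ∑ u : V, ∑ v : V, expect V p (fun S => I u S * I v S) ≤
        1 / μ ^ 2 * (μ + μ ^ 2 / r) := mul_le_mul_of_nonneg_left hsum (by positivity)
    have h2 : 1 / μ ^ 2 * (μ + μ ^ 2 / r) = 1 / μ + 1 / r := by field_simp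
    have h3 : -2 / μ * μ = -2 := by field_simp
    have h4 : (p : ℝ) / r = 1 / r - 1 := by
      rw [eq_sub_iff_add_eq, div_add_one hr0.ne', hr]; ring
    rw [h3, h4]
    linarith

end Isolated

/-! ### Choice of parameters and the two regimes -/

section Main

variable {V : Type*} [Fintype V] [DecidableEq V]

/-- The global resilience with respect to Hamiltonicity is `max 0 (δ(G) - 1)`. -/
def IsTight (G : SimpleGraph V) : Prop :=
  (globalResilience G SimpleGraph.IsHamiltonian : ℤ) = max 0 ((minDeg G : ℤ) - 1)

/-- The linear size, as a fraction of the number of vertices, up to which small sets are sparse. -/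
noncomputable def sparseFrac : ℝ := Real.exp (-224000) / 14

theorem sparseFrac_pos : 0 < sparseFrac := div_pos (Real.exp_pos _) (by norm_num)

theorem sparseFrac_le_one : sparseFrac ≤ 1 := by
  have : Real.exp (-224000) ≤ 1 := Real.exp_le_one_iff.2 (by norm_num)
  unfold sparseFrac
  linarith

/-- Unless one of the five properties in `IsRobust` fails, the deterministic argument applies; the
bound adds their failure probabilities. -/
theorem prob_not_isTight_le_of_dense (p : unitInterval) {q : ℝ} (hq : q = Fintype.card V * p)
    (hn : (Fintype.card V : ℝ) ≤ Real.exp (4 / 3 * q)) (hV : 10000 ≤ Fintype.card V)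
    (hVη : 24 / sparseFrac ^ 2 ≤ Fintype.card V) (hq200 : 200 ≤ q)
    (hqη : 10 / sparseFrac ^ 2 ≤ q) (hqθ : (16 / sparseFrac ^ 2 + 5) * (4000 / 3) ≤ q) :
    prob V p (fun G => ¬ IsTight G) ≤
      4 * (24 * 20 ^ 4) * Real.exp 43 * Real.exp (-(2 / 5 * q)) + 2 * Real.exp (-q) +
        3 * Real.exp (-Fintype.card V) := by
  set η := sparseFrac with hη
  have hη0 : 0 < η := sparseFrac_pos
  have hη1 : η ≤ 1 := sparseFrac_le_one
  have hη2 : 0 < η ^ 2 := by positivity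
  set n : ℝ := (Fintype.card V : ℝ) with hn_def
  have hn1 : 10000 ≤ n := by rw [hn_def]; exact_mod_cast hV
  have hηn : 24 ≤ η ^ 2 * n := by rwa [div_le_iff₀' hη2] at hVη
  have hηq : 10 ≤ η ^ 2 * q := by rwa [div_le_iff₀' hη2] at hqη
  have hηn1 : 24 ≤ η * n := by
    refine hηn.trans (mul_le_mul_of_nonneg_right ?_ (by linarith))
    rw [sq]; exact mul_le_of_le_one_right hη0.le hη1
  -- Rounding at most doubles ηn; the denominator 14 in `sparseFrac` absorbs this 2 and the 7 in the
  -- sparsity condition.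
  set s := ⌈η * n⌉₊ with hs_def
  have hs1 : η * n ≤ s := Nat.le_ceil _
  have hs2 : (s : ℝ) ≤ 2 * (η * n) := by
    have := (Nat.ceil_lt_add_one (by linarith : 0 ≤ η * n)).le
    linarith
  have hs : 7 * s * Real.exp 224000 ≤ n := by
    have h1 : 2 * η * 7 * Real.exp 224000 = 1 := by
      rw [hη, sparseFrac, Real.exp_neg]
      have := (Real.exp_pos 224000).ne'
      field_simp
      norm_num
    calc 7 * s * Real.exp 224000 ≤ 7 * (2 * (η * n)) * Real.exp 224000 := by
          refine mul_le_mul_of_nonneg_right ?_ (Real.exp_pos _).le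
          linarith
      _ = (2 * η * 7 * Real.exp 224000) * n := by ring
      _ = n := by rw [h1, one_mul]
  have hs4 : 4 * s ≤ Fintype.card V := by
    have h1 : (7 * s : ℝ) * 1 ≤ 7 * s * Real.exp 224000 :=
      mul_le_mul_of_nonneg_left (Real.one_le_exp (by norm_num)) (by positivity)
    have h2 : (4 * s : ℝ) ≤ n := by
      have : (0 : ℝ) ≤ s := Nat.cast_nonneg _
      linarith
    rw [hn_def] at h2
    exact_mod_cast h2
  have hs0 : 1 ≤ s := by
    have : (0 : ℝ) < s := by linarith
    exact_mod_cast this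
  set D := ⌈q / 4000⌉₊ + 1 with hD_def
  have hD1 : (D : ℝ) ≤ q / 4000 + 2 := by
    have := (Nat.ceil_lt_add_one (by linarith : 0 ≤ q / 4000)).le
    rw [hD_def]; push_cast
    linarith
  have hD2 : q ≤ 4000 * D := by
    have := Nat.le_ceil (q / 4000)
    rw [hD_def]; push_cast
    linarith
  have hD3 : 2 ≤ D := by
    have : 0 < ⌈q / 4000⌉₊ := Nat.ceil_pos.2 (by linarith)
    omega
  set h := ⌈2 * q⌉₊ with hh_def
  have hh1 : 2 * q ≤ h := Nat.le_ceil _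
  have hh2 : (h : ℝ) ≤ 2 * q + 1 := (Nat.ceil_lt_add_one (by linarith)).le
  set M := ⌊q * n / 1000⌋₊ with hM_def
  have hqn : 0 ≤ q * n := by positivity
  have hM1 : (M : ℝ) ≤ q * n / 1000 := Nat.floor_le (by positivity)
  -- Half of the density η²/4: deleting h ≤ 3q edges costs at most the other half, since η²n ≥ 24.
  set θ := η ^ 2 / 8 with hθ_def
  have hθ0 : 0 < θ := by positivity
  have hθ1 : θ ≤ 1 := by
    have : η ^ 2 ≤ 1 := pow_le_one₀ hη0.le hη1
    linarith
  -- Then (1 - θ)^k ≤ e^(-2n), which beats the 4^n pairs of sets.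
  set k := ⌈2 * n / θ⌉₊ with hk_def
  have hk1 : 2 * n / θ ≤ k := Nat.le_ceil _
  have hk2 : (k : ℝ) ≤ 2 * n / θ + 1 := (Nat.ceil_lt_add_one (by positivity)).le
  have hk3 : (1 - θ) ^ k * 4 ^ Fintype.card V < 1 := by
    have h1 : (1 - θ) ^ k ≤ Real.exp (-(2 * n)) := by
      calc (1 - θ) ^ k ≤ Real.exp (-θ) ^ k :=
            pow_le_pow_left₀ (by linarith) (by linarith [Real.add_one_le_exp (-θ)]) _
        _ = Real.exp (k * -θ) := by rw [← Real.exp_nat_mul]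
        _ ≤ _ := by
          refine Real.exp_le_exp.2 ?_
          rw [div_le_iff₀ hθ0] at hk1
          linarith
    have h2 : (4 : ℝ) ^ Fintype.card V < Real.exp (2 * n) := by
      have : Real.exp (2 * n) = Real.exp 2 ^ Fintype.card V := by
        rw [← Real.exp_nat_mul, hn_def, mul_comm]
      rw [this]
      exact pow_lt_pow_left₀ four_lt_exp_two (by norm_num) (by omega)
    calc (1 - θ) ^ k * 4 ^ Fintype.card V ≤ Real.exp (-(2 * n)) * 4 ^ Fintype.card V :=
          mul_le_mul_of_nonneg_right h1 (by positivity)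
      _ < Real.exp (-(2 * n)) * Real.exp (2 * n) := mul_lt_mul_of_pos_left h2 (Real.exp_pos _)
      _ = 1 := by rw [← Real.exp_add]; simp
  have hkM : k + Fintype.card V * D + Fintype.card V ≤ M := by
    refine Nat.le_floor ?_
    push_cast
    rw [← hn_def]
    -- The choice edges use qn/4000 of the budget qn/1000; `hqθ` makes the remaining 3qn/4000 exceed
    -- all the terms linear in n.
    have h1 : n * D ≤ n * (q / 4000 + 2) := mul_le_mul_of_nonneg_left hD1 (by linarith)
    have h2 : 2 * n / θ = 16 / η ^ 2 * n := by rw [hθ_def]; field_simp; norm_num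
    have h3 : (16 / η ^ 2 + 5) * (4000 / 3) * n ≤ q * n :=
      mul_le_mul_of_nonneg_right hqθ (by linarith)
    rw [h2] at hk2
    nlinarith
  have hθE : θ * (q * n) ≤ q * n * η ^ 2 / 4 - h := by
    have h1 : q * 24 ≤ q * (η ^ 2 * n) := mul_le_mul_of_nonneg_left hηn (by linarith)
    have h2 : θ * (q * n) = q * (η ^ 2 * n) / 8 := by rw [hθ_def]; ring
    have h3 : q * n * η ^ 2 / 4 = q * (η ^ 2 * n) / 4 := by ring
    rw [h2, h3]
    linarith
  have hEh : 2 * (q * n) ≤ n * h := by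
    have := mul_le_mul_of_nonneg_left hh1 (by linarith : 0 ≤ n)
    linarith
  refine (prob_mono (Q' := fun G =>
    ((∃ u v, u ≠ v ∧ (nbrs G u).card < 3 * D ∧ (nbrs G v).card < 3 * D ∧ Close G u v) ∨
      (∃ U : Finset V, U.Nonempty ∧ U.card ≤ 7 * s ∧
        D * U.card ≤ 14 * (edges G ∩ U.sym2).card)) ∨
    ((∃ A B : Finset V, Disjoint A B ∧ s ≤ A.card ∧ s ≤ B.card ∧
        ((edges G ∩ crossing A B).card : ℝ) < q * n * η ^ 2 / 4) ∨
      (q * n < (edges G).card ∨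
        ∃ Γ ≤ G, (edges Γ).card ≤ M ∧ (Fintype.card V / 4 + 1) ^ 2 ≤ 2 * (boosters Γ).card ∧
          (edges G ∩ boosters Γ).card ≤ h))) ?_).trans ?_
  · intro G
    contrapose!
    rintro ⟨⟨h1, h2⟩, h3, h4, h5⟩
    have hG : IsRobust G D s M h (q * n * η ^ 2 / 4) (q * n) := ⟨h1, h2, h3, h4, h5⟩
    refine globalResilience_eq (G := G) (by omega) fun H _ hH => ?_
    exact hG.isHamiltonian_sdiff (by omega) hD3 hs0 hs4 hEh hθ0.le hθ1 hθE hk3 hkM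
      (minDeg_le_card_nbrs G) hH
  · refine (prob_or_le p _ _).trans ?_
    have h1 := (prob_or_le (V := V) p _ _).trans (add_le_add
      (prob_close_le p hq (by linarith) hn hD1)
      (prob_not_sparse_le p hq hn (by linarith) hD2 hs))
    have h2 := (prob_or_le (V := V) p _ _).trans (add_le_add
      (prob_size_le p hq (by linarith)) (prob_not_boost_le p hq hq200 hV hh2 hM1))
    have h3 := (prob_or_le (V := V) p _ _).trans (add_le_add
      (prob_not_dense_le p hq hη0.le hs1 hηq) h2)
    refine (add_le_add h1 h3).trans (le_of_eq ?_)
    ring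

/-- An isolated vertex makes the minimum degree zero, so tightness holds with no deletion to
consider. The mean number of isolated vertices is at least n^(1/6). -/
theorem prob_not_isTight_le_of_sparse (p : unitInterval) (hV : 3 ≤ Fintype.card V)
    (hp : Fintype.card V * (p : ℝ) ≤ 3 / 4 * Real.log (Fintype.card V))
    (hlog : 10 * Real.log (Fintype.card V) ≤ Fintype.card V) :
    prob V p (fun G => ¬ IsTight G) ≤
      Real.exp (-(Real.log (Fintype.card V) / 6)) +
        Real.log (Fintype.card V) / Fintype.card V := by
  set n : ℝ := (Fintype.card V : ℝ) with hn_def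
  set L := Real.log n with hL
  have hn3 : 3 ≤ n := by rw [hn_def]; exact_mod_cast hV
  have hn0 : 0 < n := by linarith
  have hp0 : (0 : ℝ) ≤ p := p.2.1
  have hL0 : 0 ≤ L := Real.log_nonneg (by linarith)
  have hpL : (p : ℝ) ≤ 3 / 4 * (L / n) := by
    rw [← mul_div_assoc, le_div_iff₀ hn0]; linarith
  have hLn : L / n ≤ 1 / 10 := by
    rw [div_le_iff₀ hn0]; linarith
  have hp1 : (p : ℝ) ≤ 1 / 10 := by linarith
  set r : ℝ := 1 - p with hr
  have hr9 : 9 / 10 ≤ r := by rw [hr]; linarith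
  have hr1 : r ≤ 1 := by rw [hr]; linarith
  -- Valid for p ≤ 1/10; together with np ≤ (3/4) log n it gives (1 - p)^n ≥ n^(-5/6).
  have hrexp : Real.exp (-(10 / 9 * p)) ≤ r := by
    have h1 : 1 ≤ r * Real.exp (10 / 9 * p) := by
      have h2 : 1 + 10 / 9 * (p : ℝ) ≤ Real.exp (10 / 9 * p) := by
        linarith [Real.add_one_le_exp (10 / 9 * (p : ℝ))]
      have h3 : r * (1 + 10 / 9 * (p : ℝ)) ≤ r * Real.exp (10 / 9 * p) :=
        mul_le_mul_of_nonneg_left h2 (by linarith)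
      have h4 : 1 ≤ r * (1 + 10 / 9 * (p : ℝ)) := by rw [hr]; nlinarith
      linarith
    rw [Real.exp_neg, inv_le_iff_one_le_mul₀ (Real.exp_pos _)]
    exact h1
  refine (prob_mono (Q' := fun G => ∀ v, (nbrs G v).card ≠ 0) ?_).trans ?_
  · intro G
    contrapose!
    rintro ⟨v, hv⟩
    refine globalResilience_eq (G := G) hV fun H _ hH => ?_
    have := minDeg_le_card_nbrs G v
    omega
  · refine (prob_no_isolated_le p (by linarith) rfl (by omega)).trans (add_le_add ?_ ?_)
    · rw [← hn_def, ← hr]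
      have h1 : Real.exp (-(5 / 6 * L)) ≤ r ^ (Fintype.card V - 1) := by
        calc Real.exp (-(5 / 6 * L)) ≤ Real.exp (Fintype.card V * -(10 / 9 * p)) := by
              refine Real.exp_le_exp.2 ?_
              rw [← hn_def]
              linarith
          _ = Real.exp (-(10 / 9 * p)) ^ Fintype.card V := Real.exp_nat_mul _ _
          _ ≤ r ^ Fintype.card V := pow_le_pow_left₀ (Real.exp_pos _).le hrexp _
          _ ≤ _ := pow_le_pow_of_le_one (by linarith) hr1 (Nat.sub_le _ _)
      have h2 : Real.exp (L / 6) ≤ n * r ^ (Fintype.card V - 1) := by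
        calc Real.exp (L / 6) = Real.exp (L + -(5 / 6 * L)) := by congr 1; ring
          _ = n * Real.exp (-(5 / 6 * L)) := by rw [Real.exp_add, hL, Real.exp_log hn0]
          _ ≤ _ := mul_le_mul_of_nonneg_left h1 hn0.le
      rw [Real.exp_neg, ← one_div]
      exact one_div_le_one_div_of_le (Real.exp_pos _) h2
    · rw [← hr, div_le_iff₀ (by linarith)]
      have h1 : L / n * (9 / 10) ≤ L / n * r :=
        mul_le_mul_of_nonneg_left hr9 (div_nonneg hL0 hn0.le)
      have h2 : 0 ≤ L / n := div_nonneg hL0 hn0.le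
      linarith

theorem tendsto_prob_not_isTight (p : ℕ → unitInterval) :
    Tendsto (fun n : ℕ => prob (Fin n) (p n) (fun G => ¬ IsTight G)) atTop (𝓝 0) := by
  have hlog : Tendsto (fun n : ℕ => Real.log n) atTop atTop :=
    Real.tendsto_log_atTop.comp tendsto_natCast_atTop_atTop
  have hexp : ∀ c : ℝ, 0 < c → Tendsto (fun n : ℕ => Real.exp (-(c * Real.log n))) atTop (𝓝 0) := by
    intro c hc
    exact Real.tendsto_exp_neg_atTop_nhds_zero.comp (hlog.const_mul_atTop hc)
  have hexpn : Tendsto (fun n : ℕ => Real.exp (-(n : ℝ))) atTop (𝓝 0) :=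
    Real.tendsto_exp_neg_atTop_nhds_zero.comp tendsto_natCast_atTop_atTop
  have hdiv : Tendsto (fun n : ℕ => Real.log n / n) atTop (𝓝 0) := by
    have h1 : Tendsto (fun x : ℝ => Real.log x / x) atTop (𝓝 0) := by
      simpa using Real.isLittleO_log_id_atTop.tendsto_div_nhds_zero
    exact h1.comp tendsto_natCast_atTop_atTop
  have hbound : Tendsto (fun n : ℕ =>
      (4 * (24 * 20 ^ 4) * Real.exp 43 * Real.exp (-(3 / 10 * Real.log n)) +
        2 * Real.exp (-(3 / 4 * Real.log n)) + 3 * Real.exp (-(n : ℝ))) +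
      (Real.exp (-(1 / 6 * Real.log n)) + Real.log n / n)) atTop (𝓝 0) := by
    have := ((((hexp (3 / 10) (by norm_num)).const_mul (4 * (24 * 20 ^ 4) * Real.exp 43)).add
      ((hexp (3 / 4) (by norm_num)).const_mul 2)).add (hexpn.const_mul 3)).add
      ((hexp (1 / 6) (by norm_num)).add hdiv)
    simpa using this
  refine squeeze_zero' (Eventually.of_forall fun n => MeasureTheory.measureReal_nonneg) ?_ hbound
  have hcast : Tendsto (fun n : ℕ => (n : ℝ)) atTop atTop := tendsto_natCast_atTop_atTop
  have hq := (hlog.const_mul_atTop (by norm_num : (0 : ℝ) < 3 / 4))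
  filter_upwards [eventually_ge_atTop 10000, hcast.eventually_ge_atTop (24 / sparseFrac ^ 2),
    hq.eventually_ge_atTop 200, hq.eventually_ge_atTop (10 / sparseFrac ^ 2),
    hq.eventually_ge_atTop ((16 / sparseFrac ^ 2 + 5) * (4000 / 3)),
    hdiv.eventually_le_const (by norm_num : (0 : ℝ) < 1 / 10)] with n h1 h2 h3 h4 h5 h6
  have hn0 : (0 : ℝ) < n := by exact_mod_cast (by omega : 0 < n)
  have hL0 : 0 ≤ Real.log n := by linarith
  have hc : Fintype.card (Fin n) = n := Fintype.card_fin n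
  -- The sequence p is arbitrary and may switch regime infinitely often, so the case split is made
  -- for each n and the bound is the sum of both error terms.
  by_cases hle : (n : ℝ) * p n ≤ 3 / 4 * Real.log n
  · have := prob_not_isTight_le_of_sparse (V := Fin n) (p n) (by rw [hc]; omega)
      (by rw [hc]; exact hle) (by rw [hc]; rw [div_le_iff₀ hn0] at h6; linarith)
    rw [hc] at this
    have h7 : Real.exp (-(Real.log n / 6)) = Real.exp (-(1 / 6 * Real.log n)) := by
      congr 1; ring
    rw [h7] at this
    refine this.trans (le_add_of_nonneg_left ?_)
    positivity
  · push Not at hle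
    have := prob_not_isTight_le_of_dense (V := Fin n) (p n) (q := n * p n) (by rw [hc])
      (by
        rw [hc]
        calc (n : ℝ) = Real.exp (Real.log n) := (Real.exp_log hn0).symm
          _ ≤ _ := Real.exp_le_exp.2 (by linarith))
      (by rw [hc]; exact h1) (by rw [hc]; exact h2) (by linarith) (by linarith) (by linarith)
    rw [hc] at this
    have h7 : Real.exp (-(2 / 5 * ((n : ℝ) * p n))) ≤ Real.exp (-(3 / 10 * Real.log n)) :=
      Real.exp_le_exp.2 (by linarith)
    have h8 : Real.exp (-((n : ℝ) * p n)) ≤ Real.exp (-(3 / 4 * Real.log n)) :=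
      Real.exp_le_exp.2 (by linarith)
    have h9 : 0 ≤ Real.exp (-(1 / 6 * Real.log n)) + Real.log n / n :=
      add_nonneg (Real.exp_pos _).le (div_nonneg hL0 hn0.le)
    have h10 := mul_le_mul_of_nonneg_left h7
      (by positivity : 0 ≤ 4 * (24 * 20 ^ 4) * Real.exp 43)
    linarith

theorem tendsto_binomialRandom_isTight (p : ℕ → unitInterval) :
    Tendsto (fun n : ℕ => SimpleGraph.binomialRandom (Fin n) (p n) {G | IsTight G})
      atTop (𝓝 1) := by
  have hreal : Tendsto (fun n : ℕ => prob (Fin n) (p n) IsTight) atTop (𝓝 1) := by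
    refine tendsto_of_tendsto_of_tendsto_of_le_of_le
      (by simpa using (tendsto_prob_not_isTight p).const_sub 1) tendsto_const_nhds ?_
      fun n => prob_le_one _ _
    intro n
    have h1 := prob_or_le (V := Fin n) (p n) IsTight (fun G => ¬ IsTight G)
    have h2 : prob (Fin n) (p n) (fun G => IsTight G ∨ ¬ IsTight G) = 1 := by
      simp [prob, Classical.em]
    dsimp only
    linarith
  have := ENNReal.tendsto_ofReal hreal
  rw [ENNReal.ofReal_one] at this
  refine this.congr fun n => ?_
  exact MeasureTheory.ofReal_measureReal

end Main

end GlobalResilience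

theorem corollary1 (p : ℕ → unitInterval) :
    Tendsto
      (fun n : ℕ =>
        SimpleGraph.binomialRandom (Fin n) (p n)
          {G : SimpleGraph (Fin n) |
            (GlobalResilience.globalResilience G SimpleGraph.IsHamiltonian : ℤ) =
              max 0 ((GlobalResilience.minDeg G : ℤ) - 1)})
      atTop (𝓝 1) :=
  GlobalResilience.tendsto_binomialRandom_isTight p
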